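/- Let $a\in(0,1/14)$, let $(\Omega,\mathcal F,\mathbb P)$ be a probability space, and let $X_1,X_2,\ldots$ be independent random variables on $\Omega$ with $\mathbb P(X_n=1)=n^{-a}$ and $\mathbb P(X_n=0)=1-n^{-a}$ for every $n\ge 1$. Let $a_1(\omega)<a_2(\omega)<\cdots$ be the positive integers $k$ with $X_k(\omega)=1$, listed in increasing order (almost surely there are infinitely many). Then for $\mathbb P$-almost every $\omega$ (the exceptional null set depends on nothing that follows) we have: for every probability space $(Y,\mathcal Y,\mu)$, all measure preserving transformations $T,S\colon Y\to Y$ with $T\circ S=S\circ T$ (not assumed invertible), and every $A\in\mathcal Y$, the limit below exists and $$ \lim_{N\to\infty}\frac1N\sum_{n=1}^N\mu\bigl(A\cap T^{-n}A\cap S^{-a_n(\omega)}A\bigr)\ \ge\ \mu(A)^3 . $$ -/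

import Mathlib

open MeasureTheory ProbabilityTheory Filter Topology

/-- The random sequence of positive integers `a_1(ω) < a_2(ω) < ⋯`: the positive integers `k` with
`X_k(ω) = 1`, listed in increasing order. The index `n` starts at `1` (`Nat.nth p i` is the `i`-th
natural number satisfying `p`, where `i` starts at `0`); `X 0` plays no role. -/
noncomputable def randomSeq {Ω : Type*} (X : ℕ → Ω → ℝ) (ω : Ω) (n : ℕ) : ℕ :=
  Nat.nth (fun k : ℕ => 1 ≤ k ∧ X k ω = 1) (n - 1)

/-! ### The van der Corput inequality -/

/-! Put `f = 1_A`, `b k = 1` if `X (k+1) = 1` and `0` otherwise, `s k = (k+1)^(-a)`, and `p k = ∑ i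
< k, b i`. If `k + 1 = a_n` then `p k = n - 1`, so the average over `n` is the `b`-weighted average
over `k` of `∫ f · f∘T^(p k + 1) · f∘S^(k + 1)`. Let `F`, `G` be the mean ergodic limits of `f`
under `T` and `S`, and write the last factor as `G + (f - G)`.

The `G` part is an ordinary Cesàro average, since `G` is `S`-invariant, and tends to `∫ f F G`. This
is at least `(∫ f)³` by AM-GM, because `∫ f/F` and `∫ f/G` are at most `1`
(`integral_pow_three_le`).

The `f - G` part tends to `0`. First replace `b k` by its mean `s k`
(`tendsto_centered_correlation`). Then, since `s k → 0`, the exponent `p k` is almost constant on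
long stretches of `k`, so averaging over `S` alone suffices (`tendsto_slow_average`).

The replacement must hold off a null set independent of the system. Two applications of van der
Corput do this (`integral_sq_le_corrBound`): sorting each lag by the increment of `p` makes the
remaining integrals depend on lag and increment only, so they can be bounded by `1`. What is left,
`corrBound`, involves only `b` and `s`. Its expectation is controlled by martingale orthogonality,
and beats the square of the total weight by a power of `M` exactly because `a < 1/14`
(`corrBound_parameters`). Borel–Cantelli along polynomial scales, then interpolation, finishes. -/

theorem sum_shift_eq {M H h : ℕ} (hh : h ≤ H) (φ : ℕ → ℝ) (hφ : ∀ k, M ≤ k → φ k = 0) :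
    ∑ n ∈ Finset.range (M + H), (if h ≤ n then φ (n - h) else 0) = ∑ k ∈ Finset.range M, φ k := by
  have e : M + H = h + (M + (H - h)) := by omega
  rw [e, Finset.sum_range_add]
  have h1 : ∑ n ∈ Finset.range h, (if h ≤ n then φ (n - h) else 0) = 0 :=
    Finset.sum_eq_zero fun n hn => if_neg (by have := Finset.mem_range.1 hn; omega)
  rw [h1, zero_add, Finset.sum_range_add]
  have h3 : ∑ x ∈ Finset.range (H - h), (if h ≤ h + (M + x) then φ (h + (M + x) - h) else 0) = 0 :=
    Finset.sum_eq_zero fun n _ => by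
      rw [if_pos (by omega)]; exact hφ _ (by omega)
  rw [h3, add_zero]
  refine Finset.sum_congr rfl fun k _ => ?_
  rw [if_pos (by omega)]; congr 1; omega

theorem sum_shift_mul_shift {M H : ℕ} (u : ℕ → ℝ) (hu : ∀ k, M ≤ k → u k = 0) {h h' : ℕ}
    (hh : h ≤ h') (hH : h' ≤ H) :
    ∑ n ∈ Finset.range (M + H),
      (if h ≤ n then u (n - h) else 0) * (if h' ≤ n then u (n - h') else 0) =
      ∑ k ∈ Finset.range M, u k * u (k + Nat.dist h h') := by
  rw [← sum_shift_eq hH (fun k => u k * u (k + Nat.dist h h'))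
    (fun k hk => by simp [hu k hk])]
  refine Finset.sum_congr rfl fun n _ => ?_
  by_cases hn : h' ≤ n
  · rw [if_pos hn, if_pos (hh.trans hn), if_pos hn, mul_comm, Nat.dist_eq_sub_of_le hh]
    congr 2; omega
  · simp [hn]

/-- Cauchy–Schwarz over the `M + H` windows of length `H`: after extension by zero each term lies in
exactly `H` windows, and expanding the squared window sums produces only the lags `|h - h'|`. -/
theorem sq_sum_le_window (v : ℕ → ℝ) (M H : ℕ) :
    (H : ℝ) ^ 2 * (∑ k ∈ Finset.range M, v k) ^ 2 ≤ (M + H) *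
      ∑ h ∈ Finset.range H, ∑ h' ∈ Finset.range H,
        ∑ k ∈ Finset.range (M - Nat.dist h h'), v k * v (k + Nat.dist h h') := by
  set u : ℕ → ℝ := fun k => if k < M then v k else 0 with hu
  have hu0 : ∀ k, M ≤ k → u k = 0 := fun k hk => if_neg (by omega)
  have hu1 : ∀ k, k < M → u k = v k := fun k hk => if_pos hk
  set z : ℕ → ℝ := fun n => ∑ h ∈ Finset.range H, (if h ≤ n then u (n - h) else 0) with hz
  have hsum : ∑ n ∈ Finset.range (M + H), z n = H * ∑ k ∈ Finset.range M, v k := by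
    simp only [hz]
    rw [Finset.sum_comm, Finset.sum_congr rfl fun h hh =>
      sum_shift_eq (Finset.mem_range.1 hh).le u hu0, Finset.sum_const, Finset.card_range,
      nsmul_eq_mul]
    congr 1
    exact Finset.sum_congr rfl fun k hk => hu1 k (Finset.mem_range.1 hk)
  have hcs : (∑ n ∈ Finset.range (M + H), z n) ^ 2 ≤
      (M + H) * ∑ n ∈ Finset.range (M + H), z n ^ 2 := by
    have := @sq_sum_le_card_mul_sum_sq ℕ ℝ _ _ _ _ (Finset.range (M + H)) z
    simpa using this
  have hsq : ∑ n ∈ Finset.range (M + H), z n ^ 2 =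
      ∑ h ∈ Finset.range H, ∑ h' ∈ Finset.range H,
        ∑ k ∈ Finset.range (M - Nat.dist h h'), v k * v (k + Nat.dist h h') := by
    simp only [hz, sq, Finset.sum_mul_sum]
    rw [Finset.sum_comm]
    refine Finset.sum_congr rfl fun h hh => ?_
    rw [Finset.sum_comm]
    refine Finset.sum_congr rfl fun h' hh' => ?_
    have key : ∑ n ∈ Finset.range (M + H),
        (if h ≤ n then u (n - h) else 0) * (if h' ≤ n then u (n - h') else 0) =
        ∑ k ∈ Finset.range M, u k * u (k + Nat.dist h h') := by
      rcases le_total h h' with hle | hle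
      · exact sum_shift_mul_shift u hu0 hle (Finset.mem_range.1 hh').le
      · rw [Nat.dist_comm, ← sum_shift_mul_shift u hu0 hle (Finset.mem_range.1 hh).le]
        exact Finset.sum_congr rfl fun n _ => mul_comm _ _
    rw [key]
    set d := Nat.dist h h'
    symm
    rw [← Finset.sum_subset (Finset.range_mono (Nat.sub_le M d))]
    · refine Finset.sum_congr rfl fun k hk => ?_
      have := Finset.mem_range.1 hk
      rw [hu1 k (by omega), hu1 (k + d) (by omega)]
    · intro k hk hk'
      simp only [Finset.mem_range] at hk hk'
      rw [hu0 (k + d) (by omega), mul_zero]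
  rw [← mul_pow, ← hsum, ← hsq]
  exact hcs

/-- For fixed `h`, each distance is attained at most twice, once on either side of `h`. -/
theorem sum_dist_le (γ : ℕ → ℝ) (hγ : ∀ d, 0 ≤ γ d) {H h : ℕ} (hh : h < H) :
    ∑ h' ∈ Finset.range H, γ (Nat.dist h h') ≤ 2 * ∑ d ∈ Finset.range H, γ d := by
  have h1 : ∑ h' ∈ Finset.range (h + 1), γ (Nat.dist h h') ≤ ∑ d ∈ Finset.range H, γ d := by
    rw [← Finset.sum_range_reflect]
    refine le_trans (le_of_eq (Finset.sum_congr rfl fun k hk => ?_))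
      (Finset.sum_le_sum_of_subset_of_nonneg (Finset.range_mono (show h + 1 ≤ H from hh))
        fun d _ _ => hγ d)
    have := Finset.mem_range.1 hk
    rw [Nat.dist_comm, Nat.dist_eq_sub_of_le (by omega)]; congr 1; omega
  have h2 : ∑ h' ∈ Finset.range (H - (h + 1)), γ (Nat.dist h (h + 1 + h')) ≤
      ∑ d ∈ Finset.range H, γ d := by
    calc _ = ∑ h' ∈ Finset.range (H - (h + 1)), γ (1 + h') := by
            refine Finset.sum_congr rfl fun k _ => ?_
            rw [Nat.dist_eq_sub_of_le (by omega)]; congr 1; omega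
      _ ≤ ∑ k ∈ Finset.range 1, γ k + ∑ h' ∈ Finset.range (H - (h + 1)), γ (1 + h') :=
            le_add_of_nonneg_left (Finset.sum_nonneg fun k _ => hγ k)
      _ = ∑ d ∈ Finset.range (1 + (H - (h + 1))), γ d := (Finset.sum_range_add _ _ _).symm
      _ ≤ _ := Finset.sum_le_sum_of_subset_of_nonneg (Finset.range_mono (by omega))
        fun d _ _ => hγ d
  have e : H = h + 1 + (H - (h + 1)) := by omega
  conv_lhs => rw [e, Finset.sum_range_add]
  linarith

theorem integrable_of_abs_le {Y : Type*} [MeasurableSpace Y] {μ : Measure Y} [IsFiniteMeasure μ]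
    {f : Y → ℝ} (hf : Measurable f) (C : ℝ) (hC : ∀ y, |f y| ≤ C) : Integrable f μ :=
  Integrable.of_bound hf.aestronglyMeasurable C (ae_of_all _ hC)

theorem abs_mul_le_one {x y : ℝ} (hx : |x| ≤ 1) (hy : |y| ≤ 1) : |x * y| ≤ 1 := by
  rw [abs_mul]; exact mul_le_one₀ hx (abs_nonneg _) hy

/-- The absolute value stays outside the sum over `k`, so that cancellation in `k` can still be
exploited at each lag. -/
theorem integral_sq_sum_le_vanDerCorput {Y : Type*} [MeasurableSpace Y] {μ : Measure Y}
    [IsFiniteMeasure μ] (v : ℕ → Y → ℝ) (hv : ∀ k, Measurable (v k)) (hb : ∀ k y, |v k y| ≤ 1)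
    (M : ℕ) {H : ℕ} (hH : 0 < H) :
    ∫ y, (∑ k ∈ Finset.range M, v k y) ^ 2 ∂μ ≤ 2 * (M + H) / H *
      ∑ d ∈ Finset.range H, |∑ k ∈ Finset.range (M - d), ∫ y, v k y * v (k + d) y ∂μ| := by
  have hint : ∀ j k, Integrable (fun y => v j y * v k y) μ := fun j k =>
    integrable_of_abs_le ((hv j).mul (hv k)) 1 fun y => abs_mul_le_one (hb _ _) (hb _ _)
  set γ : ℕ → ℝ := fun d => ∑ k ∈ Finset.range (M - d), ∫ y, v k y * v (k + d) y ∂μ with hγ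
  have hpt : (H : ℝ) ^ 2 * ∫ y, (∑ k ∈ Finset.range M, v k y) ^ 2 ∂μ ≤ (M + H) *
      ∑ h ∈ Finset.range H, ∑ h' ∈ Finset.range H, γ (Nat.dist h h') := by
    have e : ∀ h h', γ (Nat.dist h h') = ∫ y, ∑ k ∈ Finset.range (M - Nat.dist h h'),
        v k y * v (k + Nat.dist h h') y ∂μ := fun h h' =>
      (integral_finsetSum _ fun k _ => hint _ _).symm
    have i1 : ∀ h h', Integrable (fun y => ∑ k ∈ Finset.range (M - Nat.dist h h'),
        v k y * v (k + Nat.dist h h') y) μ := fun h h' =>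
      integrable_finsetSum _ fun k _ => hint _ _
    have i2 : ∀ h, Integrable (fun y => ∑ h' ∈ Finset.range H,
        ∑ k ∈ Finset.range (M - Nat.dist h h'), v k y * v (k + Nat.dist h h') y) μ := fun h =>
      integrable_finsetSum _ fun k _ => i1 _ _
    simp only [e]
    rw [← integral_const_mul, Finset.sum_congr rfl fun h _ =>
      (integral_finsetSum _ fun h' _ => i1 h h').symm, ← integral_finsetSum _ fun h _ => i2 h,
      ← integral_const_mul]
    refine integral_mono ?_ ((integrable_finsetSum _ fun h _ => i2 h).const_mul _)
      fun y => sq_sum_le_window (fun k => v k y) M H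
    simp only [sq, Finset.sum_mul_sum]
    exact (integrable_finsetSum _ fun k _ => integrable_finsetSum _ fun k _ => hint _ _).const_mul _
  have hb2 : ∑ h ∈ Finset.range H, ∑ h' ∈ Finset.range H, γ (Nat.dist h h') ≤
      H * (2 * ∑ d ∈ Finset.range H, |γ d|) := by
    calc _ ≤ ∑ h ∈ Finset.range H, (2 * ∑ d ∈ Finset.range H, |γ d|) :=
          Finset.sum_le_sum fun h hh =>
            (Finset.sum_le_sum fun h' _ => le_abs_self _).trans
              (sum_dist_le (fun d => |γ d|) (fun d => abs_nonneg _) (Finset.mem_range.1 hh))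
      _ = _ := by simp
  have hH' : (0 : ℝ) < H := by exact_mod_cast hH
  have h3 := hpt.trans (mul_le_mul_of_nonneg_left hb2 (by positivity))
  rw [div_mul_eq_mul_div, le_div_iff₀ hH']
  refine le_of_mul_le_mul_left ?_ hH'
  calc _ = (H : ℝ) ^ 2 * ∫ y, (∑ k ∈ Finset.range M, v k y) ^ 2 ∂μ := by ring
    _ ≤ _ := h3
    _ = _ := by ring

/-! ### Deterministic bound for the twisted averages -/

/-- The products `y k * y (k + h)` over those `k` for which `p` increases by `r` on `[k, k + h]`. -/
def pairCorr (y : ℕ → ℝ) (p : ℕ → ℕ) (h r k : ℕ) : ℝ :=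
  if p (k + h) = p k + r then y k * y (k + h) else 0

/-- The correlation at lag `j` of the sequence `pairCorr y p h r`, restricted to those `k` for which
`p` increases by `i` on `[k, k + j]`. -/
def quadCorr (y : ℕ → ℝ) (p : ℕ → ℕ) (M h r j i : ℕ) : ℝ :=
  ∑ k ∈ Finset.range (M - h - j),
    if p (k + j) = p k + i then pairCorr y p h r k * pairCorr y p h r (k + j) else 0

/-- The bound for the square of the `L²` norm of `∑_{k < M} y k • (f ∘ T^(p k)) * (g ∘ S^k)`. -/
noncomputable def corrBound (y : ℕ → ℝ) (p : ℕ → ℕ) (M H₁ H₂ : ℕ) (lam : ℝ) : ℝ :=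
  2 * (M + H₁) / H₁ * (∑ k ∈ Finset.range M, y k ^ 2 +
    ∑ h ∈ Finset.Ico 1 H₁, ∑ r ∈ Finset.range (h + 1),
      (lam + lam⁻¹ * (2 * (M + H₂) / H₂ *
        ∑ j ∈ Finset.range H₂, ∑ i ∈ Finset.range (j + 1), |quadCorr y p M h r j i|)))

section System

variable {Y : Type*} [MeasurableSpace Y] {μ : Measure Y} [IsProbabilityMeasure μ] {T S : Y → Y}

theorem abs_pairCorr_le {y : ℕ → ℝ} (hy : ∀ k, |y k| ≤ 1) (p : ℕ → ℕ) (h r k : ℕ) :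
    |pairCorr y p h r k| ≤ 1 := by
  unfold pairCorr
  split_ifs
  · exact abs_mul_le_one (hy _) (hy _)
  · simp

/-- Exactly one `i ≤ j` is the increment of `p` on `[k, k + j]`. Hence sums can be sorted by
increment at no cost. -/
theorem sum_ite_eq_increment {p : ℕ → ℕ} (hp : ∀ k j, p k ≤ p (k + j) ∧ p (k + j) ≤ p k + j)
    (k j : ℕ) (c : ℕ → ℝ) :
    ∑ i ∈ Finset.range (j + 1), (if p (k + j) = p k + i then c i else 0) =
      c (p (k + j) - p k) := by
  have := hp k j
  rw [Finset.sum_eq_single (p (k + j) - p k)]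
  · rw [if_pos (by omega)]
  · intro i _ hi; rw [if_neg (by omega)]
  · intro hi; simp only [Finset.mem_range] at hi; omega

/-- At lag `j` with increment `i`, the two factors are `G ∘ T^i` and `G ∘ S^j` after the common map
`S^k T^(Q - p (k+j))`, which preserves `μ`. The integral therefore depends on `i` and `j` only and
comes out of the sum over `k`. All exponents are nonnegative, so no inverses are needed. -/
theorem integral_sq_twisted_le (hT : MeasurePreserving T μ μ) (hS : MeasurePreserving S μ μ)
    (hTS : Function.Commute T S) {G : Y → ℝ} (hG : Measurable G) (hG1 : ∀ y, |G y| ≤ 1)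
    {d : ℕ → ℝ} (hd : ∀ k, |d k| ≤ 1) {p : ℕ → ℕ}
    (hp : ∀ k j, p k ≤ p (k + j) ∧ p (k + j) ≤ p k + j) (K : ℕ) {H : ℕ} (hH : 0 < H) {Q : ℕ}
    (hQ : ∀ k < K, p k ≤ Q) :
    ∫ y, (∑ k ∈ Finset.range K, d k * G (S^[k] (T^[Q - p k] y))) ^ 2 ∂μ ≤ 2 * (K + H) / H *
      ∑ j ∈ Finset.range H, ∑ i ∈ Finset.range (j + 1),
        |∑ k ∈ Finset.range (K - j), if p (k + j) = p k + i then d k * d (k + j) else 0| := by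
  refine (integral_sq_sum_le_vanDerCorput (μ := μ)
    (fun k y => d k * G (S^[k] (T^[Q - p k] y)))
    (fun k => ((hG.comp ((hS.iterate k).measurable.comp
      (hT.iterate (Q - p k)).measurable)).const_mul _))
    (fun k y => abs_mul_le_one (hd k) (hG1 _)) K hH).trans ?_
  refine mul_le_mul_of_nonneg_left (Finset.sum_le_sum fun j _ => ?_) (by positivity)
  set κ : ℕ → ℝ := fun i => ∫ y, G (T^[i] y) * G (S^[j] y) ∂μ with hκ
  have hκ1 : ∀ i, |κ i| ≤ 1 := fun i => by
    have := norm_integral_le_of_norm_le_const (μ := μ) (C := 1)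
      (f := fun y => G (T^[i] y) * G (S^[j] y)) (ae_of_all μ fun y => abs_mul_le_one (hG1 (T^[i] y)) (hG1 (S^[j] y)))
    simpa using this
  have hterm : ∀ k ∈ Finset.range (K - j),
      ∫ y, d k * G (S^[k] (T^[Q - p k] y)) * (d (k + j) * G (S^[k + j] (T^[Q - p (k + j)] y))) ∂μ =
      ∑ i ∈ Finset.range (j + 1),
        κ i * (if p (k + j) = p k + i then d k * d (k + j) else 0) := by
    intro k hk
    have hk' := Finset.mem_range.1 hk
    have hq := hQ (k + j) (by omega)
    have hpk := hp k j
    simp only [mul_ite, mul_zero]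
    rw [sum_ite_eq_increment hp k j (fun i => κ i * (d k * d (k + j)))]
    set i := p (k + j) - p k
    have e : ∀ y, d k * G (S^[k] (T^[Q - p k] y)) *
        (d (k + j) * G (S^[k + j] (T^[Q - p (k + j)] y))) =
        d k * d (k + j) * (fun y => G (T^[i] y) * G (S^[j] y)) (S^[k] (T^[Q - p (k + j)] y)) := by
      intro y
      have e1 : T^[Q - p k] y = T^[i] (T^[Q - p (k + j)] y) := by
        rw [← Function.iterate_add_apply]; congr 1; omega
      have e2 : S^[k] (T^[i] (T^[Q - p (k + j)] y)) = T^[i] (S^[k] (T^[Q - p (k + j)] y)) :=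
        ((hTS.iterate_iterate i k) _).symm
      have e3 : S^[k + j] (T^[Q - p (k + j)] y) = S^[j] (S^[k] (T^[Q - p (k + j)] y)) := by
        rw [← Function.iterate_add_apply, add_comm]
      simp only [e1, e2, e3]; ring
    simp only [e]
    rw [integral_const_mul, mul_comm]
    congr 1
    have mp : MeasurePreserving (fun y => S^[k] (T^[Q - p (k + j)] y)) μ μ :=
      (hS.iterate k).comp (hT.iterate _)
    have := integral_map (μ := μ) (f := fun y => G (T^[i] y) * G (S^[j] y)) mp.measurable.aemeasurable
      (((hG.comp (hT.iterate i).measurable).mul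
        (hG.comp (hS.iterate j).measurable)).aestronglyMeasurable)
    rw [mp.map_eq] at this
    exact this.symm
  rw [Finset.sum_congr rfl hterm, Finset.sum_comm]
  refine (Finset.abs_sum_le_sum_abs _ _).trans (Finset.sum_le_sum fun i _ => ?_)
  rw [← Finset.mul_sum, abs_mul]
  exact mul_le_of_le_one_left (abs_nonneg _) (hκ1 i)

/-- A linearised Cauchy–Schwarz inequality: without square roots, expectations can be taken term by
term, and `lam` is optimised at the end. -/
theorem abs_le_add_inv_mul_sq {lam : ℝ} (hl : 0 < lam) (x : ℝ) : |x| ≤ lam + lam⁻¹ * x ^ 2 := by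
  have h : 0 ≤ (|x| - lam) ^ 2 := sq_nonneg _
  rw [← sq_abs x]
  have : lam * |x| ≤ lam * (lam + lam⁻¹ * |x| ^ 2) := by
    rw [mul_add, ← mul_assoc, mul_inv_cancel₀ hl.ne']
    nlinarith [abs_nonneg x, mul_nonneg hl.le (abs_nonneg x)]
  exact le_of_mul_le_mul_left this hl

/-- Composing the `k`-th integrand with `T^(Q - p k)` turns `F ∘ T^(p k)` into `F ∘ T^Q`, which is
the same for all `k`. It is then discarded by Cauchy–Schwarz, and van der Corput applies to what
remains. -/
theorem abs_sum_integral_le (hT : MeasurePreserving T μ μ) (hS : MeasurePreserving S μ μ)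
    (hTS : Function.Commute T S) {F G : Y → ℝ} (hF : Measurable F) (hF1 : ∀ y, |F y| ≤ 1)
    (hG : Measurable G) (hG1 : ∀ y, |G y| ≤ 1)
    {d : ℕ → ℝ} (hd : ∀ k, |d k| ≤ 1) {p : ℕ → ℕ}
    (hp : ∀ k j, p k ≤ p (k + j) ∧ p (k + j) ≤ p k + j) (K : ℕ) {H : ℕ} (hH : 0 < H)
    {lam : ℝ} (hl : 0 < lam) :
    |∑ k ∈ Finset.range K, d k * ∫ y, F (T^[p k] y) * G (S^[k] y) ∂μ| ≤
      lam + lam⁻¹ * (2 * (K + H) / H * ∑ j ∈ Finset.range H, ∑ i ∈ Finset.range (j + 1),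
        |∑ k ∈ Finset.range (K - j), if p (k + j) = p k + i then d k * d (k + j) else 0|) := by
  have hQ : ∀ k < K, p k ≤ p K := fun k hk => by
    have := (hp k (K - k)).1
    rwa [Nat.add_sub_cancel' hk.le] at this
  set Q := p K
  set φ : Y → ℝ := fun y => ∑ k ∈ Finset.range K, d k * G (S^[k] (T^[Q - p k] y)) with hφ
  have hmeas : ∀ k, Measurable fun y => d k * G (S^[k] (T^[Q - p k] y)) := fun k =>
    (hG.comp ((hS.iterate k).measurable.comp (hT.iterate (Q - p k)).measurable)).const_mul _
  have hφm : Measurable φ := Finset.measurable_fun_sum _ fun k _ => hmeas k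
  have hφb : ∀ y, |φ y| ≤ K := fun y => by
    refine (Finset.abs_sum_le_sum_abs _ _).trans ?_
    refine (Finset.sum_le_sum fun k _ => abs_mul_le_one (hd k) (hG1 _)).trans ?_
    simp
  have hFQ : Measurable fun y => F (T^[Q] y) := hF.comp (hT.iterate Q).measurable
  have e : ∑ k ∈ Finset.range K, d k * ∫ y, F (T^[p k] y) * G (S^[k] y) ∂μ =
      ∫ y, F (T^[Q] y) * φ y ∂μ := by
    simp only [hφ, Finset.mul_sum]
    rw [integral_finsetSum _ fun k _ => show Integrable
      (fun y => F (T^[Q] y) * (d k * G (S^[k] (T^[Q - p k] y)))) μ from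
      integrable_of_abs_le (hFQ.mul (hmeas k)) 1
      fun y => abs_mul_le_one (hF1 _) (abs_mul_le_one (hd k) (hG1 _))]
    refine Finset.sum_congr rfl fun k hk => ?_
    have hq := hQ k (Finset.mem_range.1 hk)
    have mp := hT.iterate (Q - p k)
    have := integral_map (μ := μ) (f := fun y => F (T^[p k] y) * G (S^[k] y))
      mp.measurable.aemeasurable
      (((hF.comp (hT.iterate _).measurable).mul
        (hG.comp (hS.iterate _).measurable)).aestronglyMeasurable)
    rw [mp.map_eq] at this
    rw [this, ← integral_const_mul]
    refine integral_congr_ae (ae_of_all _ fun y => ?_)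
    simp only
    rw [← Function.iterate_add_apply, Nat.add_sub_cancel' hq]; ring
  rw [e]
  have hφ2 : Integrable (fun y => φ y ^ 2) μ := integrable_of_abs_le (hφm.pow_const 2) ((K : ℝ) ^ 2)
    fun y => by rw [abs_pow]; exact pow_le_pow_left₀ (abs_nonneg _) (hφb y) 2
  calc |∫ y, F (T^[Q] y) * φ y ∂μ| ≤ ∫ y, |F (T^[Q] y) * φ y| ∂μ := abs_integral_le_integral_abs
    _ ≤ ∫ y, (lam + lam⁻¹ * φ y ^ 2) ∂μ := by
        refine integral_mono_of_nonneg (ae_of_all _ fun y => abs_nonneg _)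
          ((integrable_const _).add (hφ2.const_mul _)) (ae_of_all _ fun y => ?_)
        simp only [abs_mul]
        exact (mul_le_of_le_one_left (abs_nonneg _) (hF1 _)).trans (abs_le_add_inv_mul_sq hl _)
    _ = lam + lam⁻¹ * ∫ y, φ y ^ 2 ∂μ := by
        rw [integral_add (integrable_const _) (hφ2.const_mul _), integral_const_mul]; simp
    _ ≤ _ := by
        gcongr
        exact integral_sq_twisted_le hT hS hTS hG hG1 hd hp K hH hQ

/-- After van der Corput at lag `h`, terms with increment `r` have the form handled by
`abs_sum_integral_le`, with `F = f · f∘T^r`, `G = g · g∘S^h` and weights `pairCorr`. -/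
theorem integral_sq_le_corrBound (hT : MeasurePreserving T μ μ) (hS : MeasurePreserving S μ μ)
    (hTS : Function.Commute T S) {f g : Y → ℝ} (hf : Measurable f) (hf1 : ∀ y, |f y| ≤ 1)
    (hg : Measurable g) (hg1 : ∀ y, |g y| ≤ 1)
    {y : ℕ → ℝ} (hy : ∀ k, |y k| ≤ 1) {p : ℕ → ℕ}
    (hp : ∀ k j, p k ≤ p (k + j) ∧ p (k + j) ≤ p k + j) (M : ℕ) {H₁ H₂ : ℕ} (hH₁ : 0 < H₁)
    (hH₂ : 0 < H₂) {lam : ℝ} (hl : 0 < lam) :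
    ∫ x, (∑ k ∈ Finset.range M, y k * (f (T^[p k] x) * g (S^[k] x))) ^ 2 ∂μ ≤
      corrBound y p M H₁ H₂ lam := by
  have hfm : ∀ n, Measurable fun x => f (T^[n] x) := fun n => hf.comp (hT.iterate n).measurable
  have hgm : ∀ n, Measurable fun x => g (S^[n] x) := fun n => hg.comp (hS.iterate n).measurable
  refine (integral_sq_sum_le_vanDerCorput (μ := μ)
    (fun k x => y k * (f (T^[p k] x) * g (S^[k] x)))
    (fun k => ((hfm _).mul (hgm _)).const_mul _)
    (fun k x => abs_mul_le_one (hy k) (abs_mul_le_one (hf1 _) (hg1 _))) M hH₁).trans ?_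
  refine mul_le_mul_of_nonneg_left ?_ (by positivity)
  -- Lag `0` offers no cancellation and is bounded by `∑ y k ^ 2`.
  rw [Finset.range_eq_Ico, Finset.sum_eq_sum_Ico_succ_bot hH₁]
  refine add_le_add ?_ (Finset.sum_le_sum fun h hh => ?_)
  · refine (Finset.abs_sum_le_sum_abs _ _).trans (Finset.sum_le_sum fun k _ => ?_)
    have := norm_integral_le_of_norm_le_const (μ := μ) (C := y k ^ 2)
      (f := fun x => y k * (f (T^[p k] x) * g (S^[k] x)) *
        (y (k + 0) * (f (T^[p (k + 0)] x) * g (S^[k + 0] x))))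
      (ae_of_all μ fun x => by
        rw [add_zero, Real.norm_eq_abs, ← sq, abs_pow, sq_abs, mul_pow]
        refine mul_le_of_le_one_right (sq_nonneg _) ?_
        rw [← sq_abs]
        exact pow_le_one₀ (abs_nonneg _) (abs_mul_le_one (hf1 _) (hg1 _)))
    simpa using this
  · have e : ∀ k ∈ Finset.range (M - h),
        ∫ x, y k * (f (T^[p k] x) * g (S^[k] x)) *
          (y (k + h) * (f (T^[p (k + h)] x) * g (S^[k + h] x))) ∂μ =
        ∑ r ∈ Finset.range (h + 1), pairCorr y p h r k *
          ∫ x, (fun x => f x * f (T^[r] x)) (T^[p k] x) *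
            (fun x => g x * g (S^[h] x)) (S^[k] x) ∂μ := by
      intro k _
      have hpk := hp k h
      simp only [pairCorr, ite_mul, zero_mul]
      rw [sum_ite_eq_increment hp k h (fun r => y k * y (k + h) *
        ∫ x, f (T^[p k] x) * f (T^[r] (T^[p k] x)) * (g (S^[k] x) * g (S^[h] (S^[k] x))) ∂μ),
        ← integral_const_mul]
      refine integral_congr_ae (ae_of_all _ fun x => ?_)
      simp only [← Function.iterate_add_apply]
      rw [Nat.sub_add_cancel hpk.1, add_comm h k]; ring
    rw [Finset.sum_congr rfl e, Finset.sum_comm]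
    refine (Finset.abs_sum_le_sum_abs _ _).trans (Finset.sum_le_sum fun r _ => ?_)
    refine (abs_sum_integral_le hT hS hTS (F := fun x => f x * f (T^[r] x))
      (G := fun x => g x * g (S^[h] x)) (hf.mul (hfm r))
      (fun x => abs_mul_le_one (hf1 _) (hf1 _)) (hg.mul (hgm h))
      (fun x => abs_mul_le_one (hg1 _) (hg1 _)) (abs_pairCorr_le hy p h r) hp (M - h) hH₂
      hl).trans ?_
    have hMh : ((M - h : ℕ) : ℝ) ≤ M := by exact_mod_cast Nat.sub_le M h
    exact add_le_add le_rfl (mul_le_mul_of_nonneg_left (mul_le_mul_of_nonneg_right (by gcongr)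
      (Finset.sum_nonneg fun _ _ => Finset.sum_nonneg fun _ _ => abs_nonneg _))
      (inv_nonneg.2 hl.le))

end System

/-! ### Moment bounds for the random correlations -/

section Moments

variable {Ω : Type*}

/-- The `σ`-algebra generated by `b 0, …, b (n - 1)`. -/
@[reducible] def pastAlg (b : ℕ → Ω → ℕ) (n : ℕ) : MeasurableSpace Ω :=
  ⨆ k ∈ {k | k < n}, MeasurableSpace.comap (b k) ⊤

/-- The number of `i < k` with `b i = 1`. -/
def partialCount (b : ℕ → Ω → ℕ) (ω : Ω) (k : ℕ) : ℕ := ∑ i ∈ Finset.range k, b i ω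

/-- The centered variables `b k - s k`. -/
def centered (b : ℕ → Ω → ℕ) (s : ℕ → ℝ) (ω : Ω) (k : ℕ) : ℝ := (b k ω : ℝ) - s k

variable {b : ℕ → Ω → ℕ} {s : ℕ → ℝ}

theorem partialCount_increment (hb1 : ∀ k ω, b k ω ≤ 1) (ω : Ω) (k j : ℕ) :
    partialCount b ω k ≤ partialCount b ω (k + j) ∧
      partialCount b ω (k + j) ≤ partialCount b ω k + j := by
  unfold partialCount
  rw [Finset.sum_range_add]
  refine ⟨Nat.le_add_right _ _, Nat.add_le_add_left ?_ _⟩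
  exact (Finset.sum_le_sum fun i _ => hb1 _ _).trans (by simp)

theorem abs_centered_le (hb1 : ∀ k ω, b k ω ≤ 1) (hs0 : ∀ k, 0 ≤ s k) (hs1 : ∀ k, s k ≤ 1)
    (ω : Ω) (k : ℕ) : |centered b s ω k| ≤ 1 := by
  have h1 : (b k ω : ℝ) ≤ 1 := by exact_mod_cast hb1 k ω
  have h0 : (0 : ℝ) ≤ b k ω := Nat.cast_nonneg _
  unfold centered
  rw [abs_le]
  constructor <;> linarith [hs0 k, hs1 k]

theorem pastAlg_mono {m n : ℕ} (h : m ≤ n) : pastAlg b m ≤ pastAlg b n :=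
  biSup_mono fun _ hi => lt_of_lt_of_le hi h

theorem measurable_pastAlg {k n : ℕ} (h : k < n) : Measurable[pastAlg b n] (b k) := by
  have : MeasurableSpace.comap (b k) ⊤ ≤ pastAlg b n :=
    le_iSup₂ (f := fun k (_ : k ∈ {k | k < n}) => MeasurableSpace.comap (b k) ⊤) k h
  exact (comap_measurable (b k)).mono this le_rfl

theorem measurable_centered_pastAlg (s : ℕ → ℝ) {k n : ℕ} (h : k < n) :
    Measurable[pastAlg b n] (fun ω => centered b s ω k) :=
  (measurable_from_top (f := fun m : ℕ => (m : ℝ) - s k)).comp (measurable_pastAlg h)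

/-- Predictability: the count at `k` uses only indices below `k`, so conditions on increments ending
at `n` are independent of `b n`. -/
theorem measurable_partialCount_pastAlg {k n : ℕ} (h : k ≤ n) :
    Measurable[pastAlg b n] (fun ω => partialCount b ω k) := by
  unfold partialCount
  exact Finset.measurable_fun_sum _ fun i hi =>
    measurable_pastAlg (lt_of_lt_of_le (Finset.mem_range.1 hi) h)

theorem measurable_pairCorr_pastAlg (s : ℕ → ℝ) {h r k n : ℕ} (hn : k + h < n) :
    Measurable[pastAlg b n] (fun ω => pairCorr (centered b s ω) (partialCount b ω) h r k) := by
  unfold pairCorr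
  refine Measurable.ite ?_ ?_ measurable_const
  · exact measurableSet_eq_fun (measurable_partialCount_pastAlg hn.le)
      ((measurable_partialCount_pastAlg (by omega)).add_const r)
  · exact (measurable_centered_pastAlg s (by omega)).mul (measurable_centered_pastAlg s hn)

variable [mΩ : MeasurableSpace Ω]

theorem pastAlg_le (hb : ∀ k, Measurable (b k)) (n : ℕ) : pastAlg b n ≤ mΩ :=
  iSup₂_le fun k _ => (hb k).comap_le

theorem measurable_quadCorr (hb : ∀ k, Measurable (b k)) (s : ℕ → ℝ) (M h r j i : ℕ) :
    Measurable (fun ω => quadCorr (centered b s ω) (partialCount b ω) M h r j i) := by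
  unfold quadCorr
  refine Finset.measurable_fun_sum _ fun k _ => ?_
  refine Measurable.mono (ma := pastAlg b (k + j + h + 1)) ?_ (pastAlg_le hb _) le_rfl
  refine Measurable.ite ?_ ?_ measurable_const
  · exact measurableSet_eq_fun (measurable_partialCount_pastAlg (by omega))
      ((measurable_partialCount_pastAlg (by omega)).add_const i)
  · exact (measurable_pairCorr_pastAlg s (by omega)).mul (measurable_pairCorr_pastAlg s (by omega))

theorem measurable_centered (hb : ∀ k, Measurable (b k)) (s : ℕ → ℝ) (k : ℕ) :
    Measurable (fun ω => centered b s ω k) :=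
  (measurable_centered_pastAlg s (Nat.lt_succ_self k)).mono (pastAlg_le hb _) le_rfl

theorem abs_quadCorr_le {y : ℕ → ℝ} (hy : ∀ k, |y k| ≤ 1) (p : ℕ → ℕ) (M h r j i : ℕ) :
    |quadCorr y p M h r j i| ≤ M := by
  unfold quadCorr
  refine (Finset.abs_sum_le_sum_abs _ _).trans ((Finset.sum_le_sum (g := fun _ => 1)
    fun k _ => ?_).trans ?_)
  · split_ifs
    · exact abs_mul_le_one (abs_pairCorr_le hy _ _ _ _) (abs_pairCorr_le hy _ _ _ _)
    · simp
  · simp only [Finset.sum_const, Finset.card_range, mul_one, nsmul_eq_mul]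
    exact_mod_cast (by omega : M - h - j ≤ M)

variable {P : Measure Ω}

theorem integral_mul_future (hb : ∀ k, Measurable (b k)) (hind : iIndepFun b P) {n : ℕ}
    {B : Ω → ℝ} (hB : Measurable[pastAlg b n] B) (φ : ℕ → ℝ) :
    ∫ ω, B ω * φ (b n ω) ∂P = (∫ ω, B ω ∂P) * ∫ ω, φ (b n ω) ∂P := by
  have h1 : Indep (pastAlg b n) (⨆ k ∈ ({n} : Set ℕ), MeasurableSpace.comap (b k) ⊤) P :=
    indep_iSup_of_disjoint (fun k => (hb k).comap_le) hind (by simp)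
  rw [iSup_singleton] at h1
  have h2 : IndepFun B (b n) P := by
    rw [IndepFun_iff_Indep]
    exact indep_of_indep_of_le_left h1 hB.comap_le
  exact (h2.comp (φ := id) (ψ := φ) measurable_id measurable_from_top).integral_fun_mul_eq_mul_integral
    (hB.mono (pastAlg_le hb n) le_rfl).aestronglyMeasurable
    ((measurable_from_top (f := φ)).comp (hb n)).aestronglyMeasurable

variable [IsProbabilityMeasure P]

theorem integrable_cast (hb : ∀ k, Measurable (b k)) (hb1 : ∀ k ω, b k ω ≤ 1) (k : ℕ) :
    Integrable (fun ω => (b k ω : ℝ)) P :=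
  integrable_of_abs_le ((measurable_from_top (f := fun m : ℕ => (m : ℝ))).comp (hb k)) 1
    fun ω => by
      rw [abs_of_nonneg (Nat.cast_nonneg _)]
      exact_mod_cast hb1 k ω

theorem integral_centered (hb : ∀ k, Measurable (b k)) (hb1 : ∀ k ω, b k ω ≤ 1)
    (hs : ∀ k, ∫ ω, (b k ω : ℝ) ∂P = s k) (k : ℕ) : ∫ ω, centered b s ω k ∂P = 0 := by
  unfold centered
  rw [integral_sub (integrable_cast hb hb1 k) (integrable_const _), hs]; simp

theorem integral_sq_centered_le (hb : ∀ k, Measurable (b k)) (hb1 : ∀ k ω, b k ω ≤ 1)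
    (hs : ∀ k, ∫ ω, (b k ω : ℝ) ∂P = s k) (k : ℕ) : ∫ ω, centered b s ω k ^ 2 ∂P ≤ s k := by
  have e : ∀ ω, centered b s ω k ^ 2 = (1 - 2 * s k) * (b k ω : ℝ) + s k ^ 2 := fun ω => by
    have h : (b k ω : ℝ) ^ 2 = b k ω := by
      have := hb1 k ω
      interval_cases b k ω <;> simp
    unfold centered
    linear_combination h
  simp only [e]
  rw [integral_add ((integrable_cast hb hb1 k).const_mul _) (integrable_const _),
    integral_const_mul, hs]
  simp
  nlinarith [sq_nonneg (s k)]

theorem integral_mul_centered (hb : ∀ k, Measurable (b k)) (hb1 : ∀ k ω, b k ω ≤ 1)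
    (hind : iIndepFun b P) (hs : ∀ k, ∫ ω, (b k ω : ℝ) ∂P = s k) {n : ℕ} {B : Ω → ℝ}
    (hB : Measurable[pastAlg b n] B) : ∫ ω, B ω * centered b s ω n ∂P = 0 := by
  have := integral_mul_future hb hind hB (fun m => (m : ℝ) - s n)
  have h0 := integral_centered (P := P) hb hb1 hs n
  unfold centered at *
  rw [this, h0, mul_zero]

/-- The summands are martingale differences, because `B k` is determined before time `k + m`; hence
they are orthogonal. -/
theorem integral_sq_sum_mul_centered_le (hb : ∀ k, Measurable (b k)) (hb1 : ∀ k ω, b k ω ≤ 1)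
    (hind : iIndepFun b P) (hs0 : ∀ k, 0 ≤ s k) (hs1 : ∀ k, s k ≤ 1)
    (hs : ∀ k, ∫ ω, (b k ω : ℝ) ∂P = s k) (m : ℕ)
    {B : ℕ → Ω → ℝ} (hB : ∀ k, Measurable[pastAlg b (k + m)] (B k)) (hB1 : ∀ k ω, |B k ω| ≤ 1)
    (K : ℕ) :
    ∫ ω, (∑ k ∈ Finset.range K, B k ω * centered b s ω (k + m)) ^ 2 ∂P ≤
      ∑ k ∈ Finset.range K, ∫ ω, B k ω ^ 2 ∂P := by
  have hBm : ∀ k, Measurable (B k) := fun k => (hB k).mono (pastAlg_le hb _) le_rfl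
  have hy := abs_centered_le hb1 hs0 hs1
  have hym := measurable_centered hb s
  have hterm : ∀ k, Measurable[pastAlg b (k + m + 1)]
      fun ω => B k ω * centered b s ω (k + m) := fun k =>
    ((hB k).mono (pastAlg_mono (Nat.le_succ _)) le_rfl).mul
      (measurable_centered_pastAlg s (Nat.lt_succ_self _))
  induction K with
  | zero => simp
  | succ K ih =>
    set S : Ω → ℝ := fun ω => ∑ k ∈ Finset.range K, B k ω * centered b s ω (k + m) with hS
    have hSm : Measurable[pastAlg b (K + m)] S := by
      refine Finset.measurable_fun_sum _ fun k hk => (hterm k).mono (pastAlg_mono ?_) le_rfl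
      have := Finset.mem_range.1 hk
      omega
    have hSm' : Measurable S := hSm.mono (pastAlg_le hb _) le_rfl
    have hSb : ∀ ω, |S ω| ≤ K := fun ω => by
      refine (Finset.abs_sum_le_sum_abs _ _).trans ?_
      refine (Finset.sum_le_sum fun k _ => abs_mul_le_one (hB1 k ω) (hy ω _)).trans (by simp)
    have e : ∀ ω, (∑ k ∈ Finset.range (K + 1), B k ω * centered b s ω (k + m)) ^ 2 =
        S ω ^ 2 + 2 * (S ω * B K ω * centered b s ω (K + m)) +
          (B K ω * centered b s ω (K + m)) ^ 2 := fun ω => by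
      rw [Finset.sum_range_succ]; simp only [hS]; ring
    have i1 : Integrable (fun ω => S ω ^ 2) P := integrable_of_abs_le (hSm'.pow_const 2) (K ^ 2)
      fun ω => by rw [abs_pow]; exact pow_le_pow_left₀ (abs_nonneg _) (hSb ω) 2
    have i2 : Integrable (fun ω => S ω * B K ω * centered b s ω (K + m)) P :=
      integrable_of_abs_le ((hSm'.mul (hBm K)).mul (hym _)) K fun ω => by
        rw [mul_assoc, abs_mul]
        exact (mul_le_of_le_one_right (abs_nonneg _)
          (abs_mul_le_one (hB1 _ _) (hy _ _))).trans (hSb ω)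
    have i3 : Integrable (fun ω => (B K ω * centered b s ω (K + m)) ^ 2) P :=
      integrable_of_abs_le (((hBm K).mul (hym _)).pow_const 2) 1 fun ω => by
        rw [abs_pow]; exact pow_le_one₀ (abs_nonneg _) (abs_mul_le_one (hB1 _ _) (hy _ _))
    have i4 : Integrable (fun ω => B K ω ^ 2) P :=
      integrable_of_abs_le ((hBm K).pow_const 2) 1 fun ω => by
        rw [abs_pow]; exact pow_le_one₀ (abs_nonneg _) (hB1 _ _)
    simp only [e]
    have i12 : Integrable
      (fun ω => S ω ^ 2 + 2 * (S ω * B K ω * centered b s ω (K + m))) P := i1.add (i2.const_mul 2)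
    -- The earlier sum and `B K` are both known before time `K + m`, so the cross term vanishes.
    have hz : ∫ ω, S ω * B K ω * centered b s ω (K + m) ∂P = 0 :=
      integral_mul_centered hb hb1 hind hs (hSm.mul (hB K))
    rw [integral_add i12 i3, integral_add i1 (i2.const_mul 2), integral_const_mul, hz, mul_zero,
      add_zero, Finset.sum_range_succ]
    refine add_le_add ih (integral_mono i3 i4 fun ω => ?_)
    simp only [mul_pow]
    refine mul_le_of_le_one_right (sq_nonneg _) ?_
    rw [← sq_abs]; exact pow_le_one₀ (abs_nonneg _) (hy _ _)

/-- For positive `h` and `j` the index `k + j + h` is strictly the largest of the four in the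
product, so its centered factor drives the orthogonality. Summing over `r` and `i` costs nothing,
since each `k` contributes for a single pair `(r, i)` at most. -/
theorem sum_integral_sq_quadCorr_le (hb : ∀ k, Measurable (b k)) (hb1 : ∀ k ω, b k ω ≤ 1)
    (hind : iIndepFun b P) (hs0 : ∀ k, 0 ≤ s k) (hs1 : ∀ k, s k ≤ 1)
    (hs : ∀ k, ∫ ω, (b k ω : ℝ) ∂P = s k) (M : ℕ) {h j : ℕ} (hh : 0 < h) (hj : 0 < j) :
    ∑ r ∈ Finset.range (h + 1), ∑ i ∈ Finset.range (j + 1),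
      ∫ ω, quadCorr (centered b s ω) (partialCount b ω) M h r j i ^ 2 ∂P ≤ M := by
  have hy := abs_centered_le hb1 hs0 hs1
  -- The summand of `quadCorr` with its last factor, at `k + j + h`, removed.
  set B : ℕ → ℕ → ℕ → Ω → ℝ := fun r i k ω =>
    if partialCount b ω (k + j) = partialCount b ω k + i then
      pairCorr (centered b s ω) (partialCount b ω) h r k *
        (if partialCount b ω (k + j + h) = partialCount b ω (k + j) + r then
          centered b s ω (k + j) else 0) else 0 with hBdef
  have hBm : ∀ r i k, Measurable[pastAlg b (k + (j + h))] (B r i k) := fun r i k => by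
    refine Measurable.ite ?_ (Measurable.mul (measurable_pairCorr_pastAlg s (by omega))
      (Measurable.ite ?_ (measurable_centered_pastAlg s (by omega)) measurable_const))
      measurable_const
    · exact measurableSet_eq_fun (measurable_partialCount_pastAlg (by omega))
        ((measurable_partialCount_pastAlg (by omega)).add_const i)
    · exact measurableSet_eq_fun (measurable_partialCount_pastAlg (by omega))
        ((measurable_partialCount_pastAlg (by omega)).add_const r)
  have hBle : ∀ r i k ω, |B r i k ω| ≤ if partialCount b ω (k + j) = partialCount b ω k + i then
      (if partialCount b ω (k + h) = partialCount b ω k + r then 1 else 0) else 0 := by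
    intro r i k ω
    simp only [hBdef, pairCorr]
    split_ifs
    · exact abs_mul_le_one (abs_mul_le_one (hy _ _) (hy _ _)) (hy _ _)
    all_goals simp
  have hB1 : ∀ r i k ω, |B r i k ω| ≤ 1 := fun r i k ω =>
    (hBle r i k ω).trans (by split_ifs <;> norm_num)
  have hq : ∀ r i ω, quadCorr (centered b s ω) (partialCount b ω) M h r j i =
      ∑ k ∈ Finset.range (M - h - j), B r i k ω * centered b s ω (k + (j + h)) := by
    intro r i ω
    unfold quadCorr
    refine Finset.sum_congr rfl fun k _ => ?_
    simp only [hBdef, ite_mul, zero_mul]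
    refine if_congr Iff.rfl ?_ rfl
    rw [mul_assoc]
    congr 1
    simp only [pairCorr, ← add_assoc, ite_mul, zero_mul]
  have hsum : ∀ k ω, ∑ r ∈ Finset.range (h + 1), ∑ i ∈ Finset.range (j + 1), B r i k ω ^ 2 ≤ 1 := by
    intro k ω
    have hp := partialCount_increment hb1 ω
    calc _ ≤ ∑ r ∈ Finset.range (h + 1), ∑ i ∈ Finset.range (j + 1),
          (if partialCount b ω (k + j) = partialCount b ω k + i then
            (if partialCount b ω (k + h) = partialCount b ω k + r then (1 : ℝ) else 0) else 0) := by
          refine Finset.sum_le_sum fun r _ => Finset.sum_le_sum fun i _ => ?_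
          refine le_trans ?_ (hBle r i k ω)
          rw [← sq_abs]
          exact pow_le_of_le_one (abs_nonneg _) (hB1 r i k ω) two_ne_zero
      _ = 1 := by
          rw [Finset.sum_congr rfl fun r _ => sum_ite_eq_increment hp k j
            (fun _ => if partialCount b ω (k + h) = partialCount b ω k + r then (1 : ℝ) else 0)]
          exact sum_ite_eq_increment hp k h (fun _ => 1)
  have hB2 : ∀ r i k, Integrable (fun ω => B r i k ω ^ 2) P := fun r i k =>
    integrable_of_abs_le (((hBm r i k).mono (pastAlg_le hb _) le_rfl).pow_const 2) 1 fun ω => by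
      rw [abs_pow]; exact pow_le_one₀ (abs_nonneg _) (hB1 _ _ _ _)
  calc _ ≤ ∑ r ∈ Finset.range (h + 1), ∑ i ∈ Finset.range (j + 1),
        ∑ k ∈ Finset.range (M - h - j), ∫ ω, B r i k ω ^ 2 ∂P := by
        refine Finset.sum_le_sum fun r _ => Finset.sum_le_sum fun i _ => ?_
        simp only [hq]
        exact integral_sq_sum_mul_centered_le hb hb1 hind hs0 hs1 hs (j + h) (hBm r i) (hB1 r i) _
    _ = ∑ k ∈ Finset.range (M - h - j),
        ∫ ω, ∑ r ∈ Finset.range (h + 1), ∑ i ∈ Finset.range (j + 1), B r i k ω ^ 2 ∂P := by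
        rw [Finset.sum_congr rfl fun r _ => Finset.sum_comm, Finset.sum_comm]
        refine Finset.sum_congr rfl fun k _ => ?_
        rw [integral_finsetSum _ fun r _ => integrable_finsetSum _ fun i _ => hB2 r i k]
        exact Finset.sum_congr rfl fun r _ => (integral_finsetSum _ fun i _ => hB2 r i k).symm
    _ ≤ ∑ k ∈ Finset.range (M - h - j), 1 := by
        refine Finset.sum_le_sum fun k _ => ?_
        refine (integral_mono (integrable_finsetSum _ fun r _ => integrable_finsetSum _
          fun i _ => hB2 r i k) (integrable_const 1) (hsum k)).trans (by simp)
    _ ≤ M := by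
        simp only [Finset.sum_const, Finset.card_range, nsmul_eq_mul, mul_one]
        exact_mod_cast (by omega : M - h - j ≤ M)

/-- Lag `0` is the diagonal, a sum of squares. Independence of the factors at `k` and `k + h` gives
two variances, each at most `s k`. -/
theorem sum_integral_abs_quadCorr_zero_le (hb : ∀ k, Measurable (b k)) (hb1 : ∀ k ω, b k ω ≤ 1)
    (hind : iIndepFun b P) (hs0 : ∀ k, 0 ≤ s k) (hs1 : ∀ k, s k ≤ 1) (hsa : Antitone s)
    (hs : ∀ k, ∫ ω, (b k ω : ℝ) ∂P = s k) (M : ℕ) {h : ℕ} (hh : 0 < h) :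
    ∑ r ∈ Finset.range (h + 1),
      ∫ ω, |quadCorr (centered b s ω) (partialCount b ω) M h r 0 0| ∂P ≤
      ∑ k ∈ Finset.range M, s k ^ 2 := by
  have hy := abs_centered_le hb1 hs0 hs1
  have hpt : ∀ ω, ∑ r ∈ Finset.range (h + 1),
      |quadCorr (centered b s ω) (partialCount b ω) M h r 0 0| ≤
      ∑ k ∈ Finset.range M, centered b s ω k ^ 2 * centered b s ω (k + h) ^ 2 := by
    intro ω
    have hp := partialCount_increment hb1 ω
    calc _ ≤ ∑ r ∈ Finset.range (h + 1), ∑ k ∈ Finset.range M,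
          pairCorr (centered b s ω) (partialCount b ω) h r k ^ 2 := by
          refine Finset.sum_le_sum fun r _ => ?_
          unfold quadCorr
          rw [abs_of_nonneg (Finset.sum_nonneg fun k _ => by
            simp only [add_zero, if_true]; exact mul_self_nonneg _)]
          simp only [add_zero, if_true, Nat.sub_zero, ← sq]
          exact Finset.sum_le_sum_of_subset_of_nonneg (Finset.range_mono (Nat.sub_le _ _))
            fun k _ _ => sq_nonneg _
      _ = _ := by
          rw [Finset.sum_comm]
          refine Finset.sum_congr rfl fun k _ => ?_
          simp only [pairCorr, ite_pow, mul_pow, ne_eq, OfNat.ofNat_ne_zero, not_false_eq_true,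
            zero_pow]
          exact sum_ite_eq_increment hp k h
            (fun _ => centered b s ω k ^ 2 * centered b s ω (k + h) ^ 2)
  have hi : ∀ k, Integrable
      (fun ω => centered b s ω k ^ 2 * centered b s ω (k + h) ^ 2) P := fun k =>
    integrable_of_abs_le (((measurable_centered hb s k).pow_const 2).mul
      ((measurable_centered hb s _).pow_const 2)) 1 fun ω => by
        rw [← mul_pow, abs_pow]
        exact pow_le_one₀ (abs_nonneg _) (abs_mul_le_one (hy _ _) (hy _ _))
  have hiq : ∀ r, Integrable
      (fun ω => |quadCorr (centered b s ω) (partialCount b ω) M h r 0 0|) P := fun r =>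
    integrable_of_abs_le (measurable_quadCorr hb s M h r 0 0).abs M fun ω => by
      rw [abs_abs]; exact abs_quadCorr_le (hy ω) _ _ _ _ _ _
  rw [← integral_finsetSum _ fun r _ => hiq r]
  refine (integral_mono (integrable_finsetSum _ fun r _ => hiq r)
    (integrable_finsetSum _ fun k _ => hi k) hpt).trans ?_
  rw [integral_finsetSum _ fun k _ => hi k]
  refine Finset.sum_le_sum fun k _ => ?_
  have h1 := integral_mul_future hb hind (n := k + h) (B := fun ω => centered b s ω k ^ 2)
    ((measurable_centered_pastAlg s (by omega)).pow_const 2) (fun m => ((m : ℝ) - s (k + h)) ^ 2)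
  have h2 := integral_sq_centered_le (P := P) hb hb1 hs k
  have h3 := integral_sq_centered_le (P := P) hb hb1 hs (k + h)
  calc _ = (∫ ω, centered b s ω k ^ 2 ∂P) * ∫ ω, centered b s ω (k + h) ^ 2 ∂P := h1
    _ ≤ s k * s k := mul_le_mul h2 (h3.trans (hsa (Nat.le_add_right _ _)))
        (integral_nonneg fun _ => sq_nonneg _) (hs0 k)
    _ = s k ^ 2 := (sq _).symm

/-- For `j > 0` first moments are passed to second moments through `|q| ≤ η + η⁻¹ q²`. There are at
most `H₁ * H₂` pairs `(r, i)`, whence the term `H₁ * H₂ * η`. -/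
theorem integral_corrBound_le (hb : ∀ k, Measurable (b k)) (hb1 : ∀ k ω, b k ω ≤ 1)
    (hind : iIndepFun b P) (hs0 : ∀ k, 0 ≤ s k) (hs1 : ∀ k, s k ≤ 1) (hsa : Antitone s)
    (hs : ∀ k, ∫ ω, (b k ω : ℝ) ∂P = s k) (M : ℕ) {H₁ H₂ : ℕ} (hH₁ : 0 < H₁) (hH₂ : 0 < H₂)
    {lam η : ℝ} (hl : 0 < lam) (hη : 0 < η) :
    ∫ ω, corrBound (centered b s ω) (partialCount b ω) M H₁ H₂ lam ∂P ≤
      2 * (M + H₁) / H₁ * (∑ k ∈ Finset.range M, s k + H₁ * (H₁ * lam + lam⁻¹ *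
        (2 * (M + H₂) / H₂ * (∑ k ∈ Finset.range M, s k ^ 2 +
          H₂ * (H₁ * H₂ * η + η⁻¹ * M))))) := by
  have hy := abs_centered_le hb1 hs0 hs1
  have hiy : ∀ k, Integrable (fun ω => centered b s ω k ^ 2) P := fun k =>
    integrable_of_abs_le ((measurable_centered hb s k).pow_const 2) 1 fun ω => by
      rw [abs_pow]; exact pow_le_one₀ (abs_nonneg _) (hy _ _)
  have hiq : ∀ h r j i, Integrable
      (fun ω => |quadCorr (centered b s ω) (partialCount b ω) M h r j i|) P := fun h r j i =>
    integrable_of_abs_le (measurable_quadCorr hb s M h r j i).abs M fun ω => by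
      rw [abs_abs]; exact abs_quadCorr_le (hy ω) _ _ _ _ _ _
  have hiq2 : ∀ h r j i, Integrable
      (fun ω => quadCorr (centered b s ω) (partialCount b ω) M h r j i ^ 2) P := fun h r j i =>
    integrable_of_abs_le ((measurable_quadCorr hb s M h r j i).pow_const 2) (M ^ 2) fun ω => by
      rw [abs_pow]; exact pow_le_pow_left₀ (abs_nonneg _) (abs_quadCorr_le (hy ω) _ _ _ _ _ _) 2
  set q : ℕ → ℕ → ℕ → ℕ → ℝ := fun h r j i =>
    ∫ ω, |quadCorr (centered b s ω) (partialCount b ω) M h r j i| ∂P with hq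
  have i1 : ∀ h r, Integrable (fun ω => ∑ j ∈ Finset.range H₂, ∑ i ∈ Finset.range (j + 1),
      |quadCorr (centered b s ω) (partialCount b ω) M h r j i|) P := fun h r =>
    integrable_finsetSum _ fun j _ => integrable_finsetSum _ fun i _ => hiq h r j i
  have i2 : ∀ h r, Integrable (fun ω => lam + lam⁻¹ * (2 * (M + H₂) / H₂ *
      ∑ j ∈ Finset.range H₂, ∑ i ∈ Finset.range (j + 1),
      |quadCorr (centered b s ω) (partialCount b ω) M h r j i|)) P := fun h r =>
    (integrable_const _).add (((i1 h r).const_mul _).const_mul _)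
  have e : ∫ ω, corrBound (centered b s ω) (partialCount b ω) M H₁ H₂ lam ∂P =
      2 * (M + H₁) / H₁ * (∑ k ∈ Finset.range M, ∫ ω, centered b s ω k ^ 2 ∂P +
        ∑ h ∈ Finset.Ico 1 H₁, ∑ r ∈ Finset.range (h + 1), (lam + lam⁻¹ * (2 * (M + H₂) / H₂ *
          ∑ j ∈ Finset.range H₂, ∑ i ∈ Finset.range (j + 1), q h r j i))) := by
    unfold corrBound
    rw [integral_const_mul, integral_add (integrable_finsetSum _ fun k _ => hiy k)
      (integrable_finsetSum _ fun h _ => integrable_finsetSum _ fun r _ => i2 h r),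
      integral_finsetSum _ fun k _ => hiy k,
      integral_finsetSum _ fun h _ => integrable_finsetSum _ fun r _ => i2 h r]
    congr 2
    refine Finset.sum_congr rfl fun h _ => ?_
    rw [integral_finsetSum _ fun r _ => i2 h r]
    refine Finset.sum_congr rfl fun r _ => ?_
    rw [integral_add (integrable_const _) (((i1 h r).const_mul _).const_mul _),
      integral_const_mul, integral_const_mul,
      integral_finsetSum _ fun j _ => integrable_finsetSum _ fun i _ => hiq h r j i]
    simp only [integral_const, probReal_univ, smul_eq_mul, one_mul]
    congr 3
    exact Finset.sum_congr rfl fun j _ => integral_finsetSum _ fun i _ => hiq h r j i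
  have hq_le : ∀ h r j i, q h r j i ≤
      η + η⁻¹ * ∫ ω, quadCorr (centered b s ω) (partialCount b ω) M h r j i ^ 2 ∂P := by
    intro h r j i
    refine (integral_mono (hiq h r j i) ((integrable_const η).add ((hiq2 h r j i).const_mul η⁻¹))
      fun ω => abs_le_add_inv_mul_sq hη _).trans (le_of_eq ?_)
    simp only [Pi.add_apply]
    rw [integral_add (integrable_const η) ((hiq2 h r j i).const_mul η⁻¹), integral_const_mul]
    simp
  have hlag : ∀ h ∈ Finset.Ico 1 H₁, ∑ r ∈ Finset.range (h + 1), ∑ j ∈ Finset.range H₂,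
      ∑ i ∈ Finset.range (j + 1), q h r j i ≤
      ∑ k ∈ Finset.range M, s k ^ 2 + H₂ * (H₁ * H₂ * η + η⁻¹ * M) := by
    intro h hh
    obtain ⟨hh0, hh1⟩ := Finset.mem_Ico.1 hh
    rw [Finset.sum_comm, Finset.range_eq_Ico, Finset.sum_eq_sum_Ico_succ_bot hH₂]
    refine add_le_add ?_ ?_
    · simpa [hq] using
        sum_integral_abs_quadCorr_zero_le (P := P) hb hb1 hind hs0 hs1 hsa hs M hh0
    · calc _ ≤ ∑ j ∈ Finset.Ico (0 + 1) H₂, (H₁ * H₂ * η + η⁻¹ * M) := by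
            refine Finset.sum_le_sum fun j hj => ?_
            obtain ⟨hj0, hj1⟩ := Finset.mem_Ico.1 hj
            have hsq := sum_integral_sq_quadCorr_le (P := P) hb hb1 hind hs0 hs1 hs M hh0
              (show 0 < j from hj0)
            calc _ ≤ ∑ r ∈ Finset.range (h + 1), ∑ i ∈ Finset.range (j + 1), (η + η⁻¹ *
                  ∫ ω, quadCorr (centered b s ω) (partialCount b ω) M h r j i ^ 2 ∂P) :=
                  Finset.sum_le_sum fun r _ => Finset.sum_le_sum fun i _ => hq_le h r j i
              _ = ((h + 1 : ℕ) : ℝ) * ((j + 1 : ℕ) : ℝ) * η + η⁻¹ *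
                  ∑ r ∈ Finset.range (h + 1), ∑ i ∈ Finset.range (j + 1),
                  ∫ ω, quadCorr (centered b s ω) (partialCount b ω) M h r j i ^ 2 ∂P := by
                  simp only [Finset.sum_add_distrib, Finset.mul_sum, Finset.sum_const,
                    Finset.card_range, nsmul_eq_mul]
                  ring
              _ ≤ _ := by
                  gcongr
                  · exact hh1
                  · exact hj1
        _ ≤ _ := by
            rw [Finset.sum_const, Nat.card_Ico, nsmul_eq_mul]
            gcongr
            exact Nat.sub_le _ _
  rw [e]
  refine mul_le_mul_of_nonneg_left (add_le_add
    (Finset.sum_le_sum fun k _ => integral_sq_centered_le hb hb1 hs k) ?_) (by positivity)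
  have hnn : 0 ≤ ∑ k ∈ Finset.range M, s k ^ 2 + H₂ * (H₁ * H₂ * η + η⁻¹ * M) :=
    add_nonneg (Finset.sum_nonneg fun _ _ => sq_nonneg _) (by positivity)
  calc _ ≤ ∑ h ∈ Finset.Ico 1 H₁, (H₁ * lam + lam⁻¹ * (2 * (M + H₂) / H₂ *
        (∑ k ∈ Finset.range M, s k ^ 2 + H₂ * (H₁ * H₂ * η + η⁻¹ * M)))) := by
        refine Finset.sum_le_sum fun h hh => ?_
        have hh1 : h + 1 ≤ H₁ := (Finset.mem_Ico.1 hh).2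
        rw [Finset.sum_add_distrib, ← Finset.mul_sum, ← Finset.mul_sum, Finset.sum_const,
          Finset.card_range, nsmul_eq_mul]
        gcongr
        exact hlag h hh
    _ ≤ _ := by
        rw [Finset.sum_const, Nat.card_Ico, nsmul_eq_mul]
        gcongr
        exact Nat.sub_le _ _

end Moments

/-! ### Power saving in expectation -/

theorem sum_rpow_neg_le {t : ℝ} (ht0 : 0 ≤ t) (ht1 : t < 1) (M : ℕ) :
    ∑ k ∈ Finset.range M, ((k : ℝ) + 1) ^ (-t) ≤ (1 - t)⁻¹ * (M : ℝ) ^ (1 - t) := by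
  have h1t : 0 < 1 - t := by linarith
  induction M with
  | zero => simp [Real.zero_rpow h1t.ne']
  | succ M ih =>
    rw [Finset.sum_range_succ]
    set x : ℝ := (M : ℝ) + 1 with hx
    have hx0 : 0 < x := by positivity
    have hx1 : 1 ≤ x := by rw [hx]; linarith [Nat.cast_nonneg (α := ℝ) M]
    have hinv : x⁻¹ ≤ 1 := inv_le_one_of_one_le₀ hx1
    -- Bernoulli's inequality with `M = x (1 - 1/x)` plays the role of comparison with an integral.
    have hB := rpow_one_add_le_one_add_mul_self (s := -x⁻¹) (by linarith) h1t.le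
      (by linarith : 1 - t ≤ 1)
    have hM : (M : ℝ) = x * (1 + -x⁻¹) := by
      rw [mul_add, mul_neg, mul_inv_cancel₀ hx0.ne', hx]; ring
    have h2 : (M : ℝ) ^ (1 - t) ≤ x ^ (1 - t) - (1 - t) * x ^ (-t) := by
      rw [hM, Real.mul_rpow hx0.le (by linarith)]
      have e : x ^ (-t) = x ^ (1 - t) * x⁻¹ := by
        rw [← Real.rpow_neg_one x, ← Real.rpow_add hx0]; congr 1; ring
      rw [e]
      nlinarith [Real.rpow_nonneg hx0.le (1 - t)]
    have h3 : (1 - t)⁻¹ * (M : ℝ) ^ (1 - t) ≤ (1 - t)⁻¹ * x ^ (1 - t) - x ^ (-t) := by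
      calc _ ≤ (1 - t)⁻¹ * (x ^ (1 - t) - (1 - t) * x ^ (-t)) :=
            mul_le_mul_of_nonneg_left h2 (inv_nonneg.2 h1t.le)
        _ = _ := by field_simp
    push_cast
    linarith

/-- Here `u = M^a`, `v = M^δ`, `H₁ ≈ u v`, `H₂ ≈ u³v³`, `lam = u¹¹v⁸`, `η = u⁵v³`. These balance
every competing pair: `H₁H₂η` and `M/η` are both of order `u⁹v⁷`; `H₂` times this matches `S₂`; the
two terms in `hD` are both of order `u¹²v⁹`; and `H₁` times that matches `S₁`. The squared total
weight has order `u²⁶v²⁰`, so the saving is one factor `v`. -/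
theorem corrBound_parameters {u v m h₁ h₂ S₁ S₂ : ℝ} (hu : 1 ≤ u) (hv : 1 ≤ v)
    (hm : m = u ^ 14 * v ^ 10) (h1l : u * v ≤ h₁) (h1u : h₁ ≤ 2 * (u * v))
    (h2l : u ^ 3 * v ^ 3 ≤ h₂) (h2u : h₂ ≤ 2 * (u ^ 3 * v ^ 3))
    (hS₁ : S₁ ≤ 2 * (u ^ 13 * v ^ 10)) (hS₂ : S₂ ≤ 2 * (u ^ 12 * v ^ 10)) :
    2 * (m + h₁) / h₁ * (S₁ + h₁ * (h₁ * (u ^ 11 * v ^ 8) + (u ^ 11 * v ^ 8)⁻¹ *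
        (2 * (m + h₂) / h₂ * (S₂ + h₂ * (h₁ * h₂ * (u ^ 5 * v ^ 3) + (u ^ 5 * v ^ 3)⁻¹ * m))))) ≤
      408 * (u ^ 26 * v ^ 19) := by
  have hu0 : 0 < u := by linarith
  have hv0 : 0 < v := by linarith
  have h1p : 0 < h₁ := lt_of_lt_of_le (by positivity) h1l
  have h2p : 0 < h₂ := lt_of_lt_of_le (by positivity) h2l
  have hone : ∀ i j : ℕ, 1 ≤ u ^ i * v ^ j := fun i j =>
    one_le_mul_of_one_le_of_one_le (one_le_pow₀ hu) (one_le_pow₀ hv)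
  have hA : 2 * (m + h₁) / h₁ ≤ 4 * (u ^ 13 * v ^ 9) := by
    rw [div_le_iff₀ h1p, hm]
    have h3 : u ^ 14 * v ^ 10 ≤ u ^ 13 * v ^ 9 * h₁ := by
      calc u ^ 14 * v ^ 10 = u ^ 13 * v ^ 9 * (u * v) := by ring
        _ ≤ _ := by gcongr
    have h4 : h₁ ≤ u ^ 13 * v ^ 9 * h₁ := le_mul_of_one_le_left h1p.le (hone _ _)
    linarith
  have hB : 2 * (m + h₂) / h₂ ≤ 4 * (u ^ 11 * v ^ 7) := by
    rw [div_le_iff₀ h2p, hm]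
    have h3 : u ^ 14 * v ^ 10 ≤ u ^ 11 * v ^ 7 * h₂ := by
      calc u ^ 14 * v ^ 10 = u ^ 11 * v ^ 7 * (u ^ 3 * v ^ 3) := by ring
        _ ≤ _ := by gcongr
    have h4 : h₂ ≤ u ^ 11 * v ^ 7 * h₂ := le_mul_of_one_le_left h2p.le (hone _ _)
    linarith
  have hm0 : 0 < m := by rw [hm]; positivity
  have hC : h₂ * (h₁ * h₂ * (u ^ 5 * v ^ 3) + (u ^ 5 * v ^ 3)⁻¹ * m) ≤ 10 * (u ^ 12 * v ^ 10) := by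
    have e : (u ^ 5 * v ^ 3)⁻¹ * m = u ^ 9 * v ^ 7 := by rw [hm]; field_simp
    rw [e]
    calc _ ≤ 2 * (u ^ 3 * v ^ 3) *
          (2 * (u * v) * (2 * (u ^ 3 * v ^ 3)) * (u ^ 5 * v ^ 3) + u ^ 9 * v ^ 7) := by gcongr
      _ = _ := by ring
  have hD : h₁ * (u ^ 11 * v ^ 8) + (u ^ 11 * v ^ 8)⁻¹ *
      (2 * (m + h₂) / h₂ * (S₂ + h₂ * (h₁ * h₂ * (u ^ 5 * v ^ 3) + (u ^ 5 * v ^ 3)⁻¹ * m))) ≤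
      50 * (u ^ 12 * v ^ 9) := by
    calc _ ≤ 2 * (u * v) * (u ^ 11 * v ^ 8) + (u ^ 11 * v ^ 8)⁻¹ *
          (2 * (m + h₂) / h₂ * (12 * (u ^ 12 * v ^ 10))) := by
          gcongr
          linarith
      _ ≤ 2 * (u * v) * (u ^ 11 * v ^ 8) + (u ^ 11 * v ^ 8)⁻¹ *
          (4 * (u ^ 11 * v ^ 7) * (12 * (u ^ 12 * v ^ 10))) := by gcongr
      _ = _ := by field_simp; ring
  calc _ ≤ 2 * (m + h₁) / h₁ * (2 * (u ^ 13 * v ^ 10) + h₁ * (50 * (u ^ 12 * v ^ 9))) := by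
        gcongr
    _ ≤ 4 * (u ^ 13 * v ^ 9) *
        (2 * (u ^ 13 * v ^ 10) + 2 * (u * v) * (50 * (u ^ 12 * v ^ 9))) := by gcongr
    _ = _ := by ring

theorem ceil_bounds {x : ℝ} (hx : 1 ≤ x) : 0 < ⌈x⌉₊ ∧ x ≤ ⌈x⌉₊ ∧ (⌈x⌉₊ : ℝ) ≤ 2 * x :=
  ⟨Nat.ceil_pos.2 (by linarith), Nat.le_ceil x,
    (Nat.ceil_lt_add_one (by linarith)).le.trans (by linarith)⟩

/-- A `0`-`1` sequence `b` with density profile `s` whose correlations are small along a sequence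
of scales. -/
def HasSmallCorrelations (b : ℕ → ℕ) (s : ℕ → ℝ) : Prop :=
  ∃ (M H₁ H₂ : ℕ → ℕ) (lam : ℕ → ℝ), StrictMono M ∧ 0 < M 0 ∧
    Tendsto (fun n => (M (n + 1) : ℝ) / M n) atTop (𝓝 1) ∧
    (∀ n, 0 < H₁ n) ∧ (∀ n, 0 < H₂ n) ∧ (∀ n, 0 < lam n) ∧
    Tendsto (fun n => corrBound (fun k => b k - s k) (fun k => ∑ i ∈ Finset.range k, b i) (M n)
      (H₁ n) (H₂ n) (lam n) / (∑ k ∈ Finset.range (M n), s k) ^ 2) atTop (𝓝 0)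

theorem corrBound_nonneg (y : ℕ → ℝ) (p : ℕ → ℕ) (M H₁ H₂ : ℕ) {lam : ℝ} (hl : 0 < lam) :
    0 ≤ corrBound y p M H₁ H₂ lam := by
  unfold corrBound
  refine mul_nonneg (by positivity) (add_nonneg (Finset.sum_nonneg fun _ _ => sq_nonneg _)
    (Finset.sum_nonneg fun _ _ => Finset.sum_nonneg fun _ _ => add_nonneg hl.le
      (mul_nonneg (inv_nonneg.2 hl.le) (mul_nonneg (by positivity) (Finset.sum_nonneg fun _ _ =>
        Finset.sum_nonneg fun _ _ => abs_nonneg _)))))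

theorem ae_tendsto_zero_of_summable_integral {Ω : Type*} [MeasurableSpace Ω] {P : Measure Ω}
    {f : ℕ → Ω → ℝ} (hf : ∀ n, Integrable (f n) P) (h0 : ∀ n ω, 0 ≤ f n ω) {c : ℕ → ℝ}
    (hc : Summable c) (hfc : ∀ n, ∫ ω, f n ω ∂P ≤ c n) :
    ∀ᵐ ω ∂P, Tendsto (fun n => f n ω) atTop (𝓝 0) := by
  have hc0 : ∀ n, 0 ≤ c n := fun n => (integral_nonneg (h0 n)).trans (hfc n)
  have hmeas : ∀ n, AEMeasurable (fun ω => ENNReal.ofReal (f n ω)) P := fun n =>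
    (hf n).aemeasurable.ennreal_ofReal
  have hlt : ∫⁻ ω, ∑' n, ENNReal.ofReal (f n ω) ∂P ≠ ⊤ := by
    rw [lintegral_tsum hmeas]
    refine ne_top_of_le_ne_top (hc.tsum_ofReal_ne_top) (ENNReal.tsum_le_tsum fun n => ?_)
    rw [← ofReal_integral_eq_lintegral_ofReal (hf n) (ae_of_all _ (h0 n))]
    exact ENNReal.ofReal_le_ofReal (hfc n)
  filter_upwards [ae_lt_top' (AEMeasurable.tsum hmeas) hlt] with ω hω
  have h1 := ENNReal.tendsto_atTop_zero_of_tsum_ne_top hω.ne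
  have h2 := (ENNReal.tendsto_toReal ENNReal.zero_ne_top).comp h1
  simpa [Function.comp_def, ENNReal.toReal_ofReal (h0 _ ω)] using h2

/-! ### Almost sure smallness of the correlations along polynomial scales -/

section RandomSequence

variable {Ω : Type*} [MeasurableSpace Ω] {P : Measure Ω} [IsProbabilityMeasure P]
  {b : ℕ → Ω → ℕ} {a : ℝ}

theorem rpow_neg_antitone (ha0 : 0 < a) : Antitone fun k : ℕ => ((k : ℝ) + 1) ^ (-a) :=
  fun i j hij => Real.rpow_le_rpow_of_nonpos (by positivity) (by gcongr) (by linarith)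

theorem rpow_neg_le_one (ha0 : 0 < a) (k : ℕ) : ((k : ℝ) + 1) ^ (-a) ≤ 1 :=
  Real.rpow_le_one_of_one_le_of_nonpos (by linarith [Nat.cast_nonneg (α := ℝ) k]) (by linarith)

theorem le_sum_rpow_neg (ha0 : 0 < a) {M : ℕ} (hM : 0 < M) :
    (M : ℝ) ^ (1 - a) ≤ ∑ k ∈ Finset.range M, ((k : ℝ) + 1) ^ (-a) := by
  have hM0 : (0 : ℝ) < M := by exact_mod_cast hM
  calc (M : ℝ) ^ (1 - a) = ∑ k ∈ Finset.range M, (M : ℝ) ^ (-a) := by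
        rw [Finset.sum_const, Finset.card_range, nsmul_eq_mul, sub_eq_add_neg,
          Real.rpow_add hM0, Real.rpow_one]
    _ ≤ _ := Finset.sum_le_sum fun k hk =>
        Real.rpow_le_rpow_of_nonpos (by positivity)
          (by exact_mod_cast Finset.mem_range.1 hk) (by linarith)

/-- The relation between `a` and `δ` is `14 a + 10 δ = 1` halved, that is, `M = u¹⁴v¹⁰`; it allows
`δ > 0` precisely when `a < 1/14`. -/
theorem exists_integral_corrBound_le (ha0 : 0 < a) (ha : a < 1 / 14)
    (hb : ∀ k, Measurable (b k)) (hb1 : ∀ k ω, b k ω ≤ 1) (hind : iIndepFun b P)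
    (hs : ∀ k, ∫ ω, (b k ω : ℝ) ∂P = ((k : ℝ) + 1) ^ (-a)) {δ : ℝ} (hδ : 7 * a + 5 * δ = 1 / 2)
    {M : ℕ} (hM : 0 < M) :
    ∃ H₁ H₂ : ℕ, ∃ lam : ℝ, 0 < H₁ ∧ 0 < H₂ ∧ 0 < lam ∧
      ∫ ω, corrBound (centered b (fun k => ((k : ℝ) + 1) ^ (-a)) ω) (partialCount b ω)
        M H₁ H₂ lam ∂P ≤ 408 * (M : ℝ) ^ (2 - 2 * a - δ) := by
  have hM1 : (1 : ℝ) ≤ M := by exact_mod_cast hM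
  have hM0 : (0 : ℝ) < M := by linarith
  have hδ0 : 0 < δ := by linarith
  set u : ℝ := (M : ℝ) ^ a with hu
  set v : ℝ := (M : ℝ) ^ δ with hv
  have hu1 : 1 ≤ u := Real.one_le_rpow hM1 ha0.le
  have hv1 : 1 ≤ v := Real.one_le_rpow hM1 hδ0.le
  have hpow : ∀ i j : ℕ, u ^ i * v ^ j = (M : ℝ) ^ (a * i + δ * j) := fun i j => by
    rw [hu, hv, ← Real.rpow_natCast, ← Real.rpow_natCast, ← Real.rpow_mul hM0.le,
      ← Real.rpow_mul hM0.le, ← Real.rpow_add hM0]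
  have hm : (M : ℝ) = u ^ 14 * v ^ 10 := by
    rw [hpow]
    conv_lhs => rw [← Real.rpow_one (M : ℝ)]
    congr 1; push_cast; linarith
  obtain ⟨p1, l1, r1⟩ := ceil_bounds (one_le_mul_of_one_le_of_one_le hu1 hv1)
  obtain ⟨p2, l2, r2⟩ := ceil_bounds
    (one_le_mul_of_one_le_of_one_le (one_le_pow₀ hu1 (n := 3)) (one_le_pow₀ hv1 (n := 3)))
  refine ⟨⌈u * v⌉₊, ⌈u ^ 3 * v ^ 3⌉₊, u ^ 11 * v ^ 8, p1, p2, by positivity, ?_⟩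
  have hS : ∀ t : ℝ, 0 ≤ t → t ≤ 1 / 2 →
      ∑ k ∈ Finset.range M, ((k : ℝ) + 1) ^ (-t) ≤ 2 * (M : ℝ) ^ (1 - t) := fun t h0 h1 => by
    refine (sum_rpow_neg_le h0 (by linarith) M).trans ?_
    gcongr
    rw [inv_le_comm₀ (by linarith) (by norm_num)]; linarith
  refine (integral_corrBound_le (P := P) hb hb1 hind (fun k => by positivity)
    (rpow_neg_le_one ha0) (rpow_neg_antitone ha0) hs M p1 p2
    (by positivity) (show 0 < u ^ 5 * v ^ 3 by positivity)).trans ?_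
  have e : (M : ℝ) ^ (2 - 2 * a - δ) = u ^ 26 * v ^ 19 := by
    rw [hpow]; congr 1; push_cast; linarith
  rw [e]
  refine corrBound_parameters hu1 hv1 hm l1 r1 l2 r2 ?_ ?_
  · rw [hpow, show a * (13 : ℕ) + δ * (10 : ℕ) = 1 - a by push_cast; linarith]
    exact hS a ha0.le (by linarith)
  · rw [hpow, show a * (12 : ℕ) + δ * (10 : ℕ) = 1 - 2 * a by push_cast; linarith]
    refine le_trans (le_of_eq (Finset.sum_congr rfl fun k _ => ?_)) (hS (2 * a) (by linarith)
      (by linarith))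
    rw [← Real.rpow_natCast, ← Real.rpow_mul (by positivity)]; congr 1; push_cast; ring

theorem tendsto_pow_ratio (K : ℕ) :
    Tendsto (fun n : ℕ => (((n + 1 + 1) ^ K : ℕ) : ℝ) / ((n + 1) ^ K : ℕ)) atTop (𝓝 1) := by
  have h : Tendsto (fun n : ℕ => (1 + 1 / ((n : ℝ) + 1)) ^ K) atTop (𝓝 ((1 + 0) ^ K)) :=
    (tendsto_one_div_add_atTop_nhds_zero_nat.const_add 1).pow K
  rw [add_zero, one_pow] at h
  refine h.congr fun n => ?_
  push_cast
  rw [← div_pow]; congr 1; field_simp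

theorem ae_hasSmallCorrelations (ha0 : 0 < a) (ha : a < 1 / 14)
    (hb : ∀ k, Measurable (b k)) (hb1 : ∀ k ω, b k ω ≤ 1) (hind : iIndepFun b P)
    (hs : ∀ k, ∫ ω, (b k ω : ℝ) ∂P = ((k : ℝ) + 1) ^ (-a)) :
    ∀ᵐ ω ∂P, HasSmallCorrelations (fun k => b k ω) (fun k => ((k : ℝ) + 1) ^ (-a)) := by
  set δ : ℝ := (1 / 2 - 7 * a) / 5 with hδdef
  have hδ : 7 * a + 5 * δ = 1 / 2 := by rw [hδdef]; ring
  have hδ0 : 0 < δ := by linarith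
  -- With `K δ ≥ 2` the relative saving `M^(-δ)` at `M = (n+1)^K` is at most `(n+1)^(-2)`, which is
  -- summable, while consecutive scales still have ratio tending to `1`.
  obtain ⟨K, hK⟩ := exists_nat_ge (2 / δ)
  have hKδ : 2 ≤ K * δ := (div_le_iff₀ hδ0).1 hK
  have hK0 : K ≠ 0 := by rintro rfl; simp at hKδ; linarith
  set M : ℕ → ℕ := fun n => (n + 1) ^ K with hM
  have hMpos : ∀ n, 0 < M n := fun n => by positivity
  choose H₁ H₂ lam p1 p2 pl hI using fun n =>
    exists_integral_corrBound_le (P := P) ha0 ha hb hb1 hind hs hδ (hMpos n)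
  set s : ℕ → ℝ := fun k => ((k : ℝ) + 1) ^ (-a) with hsdef
  set W : ℕ → ℝ := fun n => ∑ k ∈ Finset.range (M n), s k with hW
  have hWle : ∀ n, (M n : ℝ) ^ (1 - a) ≤ W n := fun n => le_sum_rpow_neg ha0 (hMpos n)
  have hM0 : ∀ n, (0 : ℝ) < M n := fun n => by exact_mod_cast hMpos n
  have hWpos : ∀ n, 0 < W n := fun n => lt_of_lt_of_le (Real.rpow_pos_of_pos (hM0 n) _) (hWle n)
  have hy := abs_centered_le hb1 (s := s) (fun k => by positivity) (rpow_neg_le_one ha0)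
  have hint : ∀ n, Integrable (fun ω => corrBound (centered b s ω) (partialCount b ω) (M n)
      (H₁ n) (H₂ n) (lam n)) P := fun n => by
    unfold corrBound
    refine (Integrable.add (integrable_finsetSum _ fun k _ => ?_) (integrable_finsetSum _ fun h _ =>
      integrable_finsetSum _ fun r _ => (integrable_const _).add (((integrable_finsetSum _ fun j _ =>
        integrable_finsetSum _ fun i _ => ?_).const_mul _).const_mul _))).const_mul _
    · exact integrable_of_abs_le ((measurable_centered hb s k).pow_const 2) 1 fun ω => by
        rw [abs_pow]; exact pow_le_one₀ (abs_nonneg _) (hy _ _)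
    · exact integrable_of_abs_le (measurable_quadCorr hb s (M n) h r j i).abs (M n) fun ω => by
        rw [abs_abs]; exact abs_quadCorr_le (hy ω) _ _ _ _ _ _
  have hsum : Summable fun n : ℕ => 408 * (1 / ((n + 1 : ℕ) : ℝ) ^ 2) :=
    (((summable_nat_add_iff 1).2 (Real.summable_one_div_nat_pow.2 one_lt_two))).mul_left _
  have key := ae_tendsto_zero_of_summable_integral (P := P)
    (f := fun n ω => corrBound (centered b s ω) (partialCount b ω) (M n)
      (H₁ n) (H₂ n) (lam n) / W n ^ 2) (fun n => (hint n).div_const _)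
    (fun n ω => div_nonneg (corrBound_nonneg _ _ _ _ _ (pl n)) (sq_nonneg _)) hsum (fun n => by
      rw [integral_div, div_le_iff₀ (by have := hWpos n; positivity)]
      refine (hI n).trans ?_
      have hn1 : (1 : ℝ) ≤ ((n + 1 : ℕ) : ℝ) := by exact_mod_cast Nat.le_add_left 1 n
      have hpw : (M n : ℝ) ^ (2 - 2 * a - δ) = ((M n : ℝ) ^ δ)⁻¹ * ((M n : ℝ) ^ (1 - a)) ^ 2 := by
        rw [← Real.rpow_neg (hM0 n).le, ← Real.rpow_natCast, ← Real.rpow_mul (hM0 n).le,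
          ← Real.rpow_add (hM0 n)]
        congr 1; push_cast; ring
      rw [hpw, mul_assoc]
      have h2 : ((n + 1 : ℕ) : ℝ) ^ 2 ≤ (M n : ℝ) ^ δ := by
        simp only [hM, Nat.cast_pow]
        rw [← Real.rpow_natCast _ K, ← Real.rpow_mul (by positivity), ← Real.rpow_natCast _ 2]
        exact Real.rpow_le_rpow_of_exponent_le hn1 (by push_cast; exact hKδ)
      have h3 : ((M n : ℝ) ^ δ)⁻¹ ≤ 1 / ((n + 1 : ℕ) : ℝ) ^ 2 := by
        rw [one_div]; exact inv_anti₀ (by positivity) h2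
      have h4 := hWle n
      gcongr)
  filter_upwards [key] with ω hω
  refine ⟨M, H₁, H₂, lam, ?_, hMpos 0, tendsto_pow_ratio K, p1, p2, pl, hω⟩
  exact fun i j hij => Nat.pow_lt_pow_left (by omega) hK0

end RandomSequence

/-! ### From sparse scales to all scales -/

theorem exists_scale_between {M : ℕ → ℕ} (hM : StrictMono M) {m : ℕ} (hm : M 0 ≤ m) :
    ∃ n, M n ≤ m ∧ m < M (n + 1) := by
  have hex : ∃ n, m < M (n + 1) := ⟨m, lt_of_lt_of_le (Nat.lt_succ_self m) (hM.id_le _)⟩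
  classical
  refine ⟨Nat.find hex, ?_, Nat.find_spec hex⟩
  rcases Nat.eq_zero_or_pos (Nat.find hex) with h | h
  · rwa [h]
  · have := Nat.find_min hex (m := Nat.find hex - 1) (by omega)
    rw [Nat.sub_add_cancel h] at this
    omega

section Scales

variable {b : ℕ → ℕ} {s : ℕ → ℝ}

theorem sum_range_pos (hs0 : ∀ k, 0 < s k) {M : ℕ} (hM : 0 < M) :
    0 < ∑ k ∈ Finset.range M, s k :=
  Finset.sum_pos (fun k _ => hs0 k) ⟨0, Finset.mem_range.2 hM⟩

/-- By monotonicity every value of `s` beyond `M` is at most `s (M - 1)`, which is at most the mean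
of `s` over `range M`. -/
theorem sum_range_diff_le (hsa : Antitone s) (hs0 : ∀ k, 0 < s k) {M M' : ℕ} (hM : 0 < M)
    (hMM : M ≤ M') :
    (∑ k ∈ Finset.range M', s k - ∑ k ∈ Finset.range M, s k) / ∑ k ∈ Finset.range M, s k ≤
      (M' : ℝ) / M - 1 := by
  have hM0 : (0 : ℝ) < M := by exact_mod_cast hM
  have h1 : ∑ k ∈ Finset.range M', s k - ∑ k ∈ Finset.range M, s k ≤ (M' - M) * s (M - 1) := by
    rw [← Finset.sum_Ico_eq_sub _ hMM]
    refine (Finset.sum_le_sum fun k hk => hsa (show M - 1 ≤ k by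
      have := (Finset.mem_Ico.1 hk).1; omega)).trans ?_
    rw [Finset.sum_const, Nat.card_Ico, nsmul_eq_mul, Nat.cast_sub hMM]
  have h2 : M * s (M - 1) ≤ ∑ k ∈ Finset.range M, s k := by
    calc (M : ℝ) * s (M - 1) = ∑ k ∈ Finset.range M, s (M - 1) := by simp
      _ ≤ _ := Finset.sum_le_sum fun k hk => hsa (by have := Finset.mem_range.1 hk; omega)
  rw [div_le_iff₀ (sum_range_pos hs0 hM), div_sub_one hM0.ne', div_mul_eq_mul_div, le_div_iff₀ hM0]
  have h3 : (0 : ℝ) ≤ M' - M := sub_nonneg.2 (by exact_mod_cast hMM)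
  nlinarith

theorem tendsto_div_zero_of_sq_le {D R W : ℕ → ℝ} (hD : ∀ n, D n ^ 2 ≤ R n)
    (hR : Tendsto (fun n => R n / W n ^ 2) atTop (𝓝 0)) :
    Tendsto (fun n => D n / W n) atTop (𝓝 0) := by
  have h := hR.sqrt
  rw [Real.sqrt_zero] at h
  refine squeeze_zero_norm (fun n => ?_) h
  rw [Real.norm_eq_abs, ← Real.sqrt_sq_eq_abs, div_pow]
  exact Real.sqrt_le_sqrt (div_le_div_of_nonneg_right (hD n) (sq_nonneg _))

/-- Between consecutive scales the sum of `z` moves by at most the sum of `b + s` over the gap. That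
equals the change of `Z` plus twice the change of `W`, and both are `o(W)`. -/
theorem tendsto_sum_div_of_scales (hsa : Antitone s) (hs0 : ∀ k, 0 < s k)
    {M : ℕ → ℕ} (hM : StrictMono M) (hM0 : 0 < M 0)
    (hratio : Tendsto (fun n => (M (n + 1) : ℝ) / M n) atTop (𝓝 1)) {z : ℕ → ℝ}
    (hz : ∀ k, |z k| ≤ b k + s k)
    (hD : Tendsto (fun n => (∑ k ∈ Finset.range (M n), z k) / ∑ k ∈ Finset.range (M n), s k)
      atTop (𝓝 0))
    (hY : Tendsto (fun n => (∑ k ∈ Finset.range (M n), ((b k : ℝ) - s k)) /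
      ∑ k ∈ Finset.range (M n), s k) atTop (𝓝 0)) :
    Tendsto (fun m => (∑ k ∈ Finset.range m, z k) / ∑ k ∈ Finset.range m, s k)
      atTop (𝓝 0) := by
  set W : ℕ → ℝ := fun m => ∑ k ∈ Finset.range m, s k with hWdef
  set Z : ℕ → ℝ := fun m => ∑ k ∈ Finset.range m, ((b k : ℝ) - s k) with hZ
  have hMpos : ∀ n, 0 < M n := fun n => lt_of_lt_of_le hM0 (hM.monotone (Nat.zero_le n))
  have hWpos : ∀ n, 0 < W (M n) := fun n => sum_range_pos hs0 (hMpos n)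
  have hWmono : Monotone W := fun i j hij =>
    Finset.sum_le_sum_of_subset_of_nonneg (Finset.range_mono hij) fun k _ _ => (hs0 k).le
  have hgap : Tendsto (fun n => (W (M (n + 1)) - W (M n)) / W (M n)) atTop (𝓝 0) := by
    refine squeeze_zero (fun n => div_nonneg (sub_nonneg.2 (hWmono (hM.monotone (Nat.le_succ n))))
      (hWpos n).le) (fun n => sum_range_diff_le hsa hs0 (hMpos n) (hM.monotone (Nat.le_succ n))) ?_
    simpa using hratio.sub_const 1
  have hYs : Tendsto (fun n => Z (M (n + 1)) / W (M n)) atTop (𝓝 0) := by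
    have h1 : Tendsto (fun n => Z (M (n + 1)) / W (M (n + 1)) *
        ((W (M (n + 1)) - W (M n)) / W (M n) + 1)) atTop (𝓝 (0 * (0 + 1))) :=
      ((tendsto_add_atTop_iff_nat 1).2 hY).mul (hgap.add_const 1)
    rw [zero_mul] at h1
    refine h1.congr fun n => ?_
    have h2 := (hWpos n).ne'
    have h3 := (hWpos (n + 1)).ne'
    field_simp
    ring
  set e : ℕ → ℝ := fun n => |(∑ k ∈ Finset.range (M n), z k) / W (M n)| +
    (Z (M (n + 1)) / W (M n) - Z (M n) / W (M n) + 2 * ((W (M (n + 1)) - W (M n)) / W (M n)))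
    with he
  have he0 : Tendsto e atTop (𝓝 0) := by
    have := hD.abs.add ((hYs.sub hY).add (hgap.const_mul 2))
    simp only [abs_zero, sub_zero, mul_zero, add_zero] at this
    exact this
  have hbound : ∀ n m, M n ≤ m → m < M (n + 1) → |(∑ k ∈ Finset.range m, z k) / W m| ≤ e n := by
    intro n m h1 h2
    have hWm : W (M n) ≤ W m := hWmono h1
    have hsplit : |∑ k ∈ Finset.range m, z k| ≤ |∑ k ∈ Finset.range (M n), z k| +
        ((Z (M (n + 1)) - Z (M n)) + 2 * (W (M (n + 1)) - W (M n))) := by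
      have e1 : ∑ k ∈ Finset.range m, z k =
          ∑ k ∈ Finset.range (M n), z k + ∑ k ∈ Finset.Ico (M n) m, z k := by
        rw [Finset.sum_Ico_eq_sub _ h1]; ring
      have e2 : (Z (M (n + 1)) - Z (M n)) + 2 * (W (M (n + 1)) - W (M n)) =
          ∑ k ∈ Finset.Ico (M n) (M (n + 1)), ((b k : ℝ) + s k) := by
        simp only [hZ, hWdef]
        rw [← Finset.sum_Ico_eq_sub _ (h1.trans h2.le), ← Finset.sum_Ico_eq_sub _ (h1.trans h2.le),
          Finset.mul_sum, ← Finset.sum_add_distrib]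
        exact Finset.sum_congr rfl fun k _ => by ring
      rw [e1, e2]
      refine (abs_add_le _ _).trans (add_le_add le_rfl ((Finset.abs_sum_le_sum_abs _ _).trans ?_))
      refine (Finset.sum_le_sum fun k _ => hz k).trans ?_
      exact Finset.sum_le_sum_of_subset_of_nonneg (Finset.Ico_subset_Ico_right h2.le)
        fun k _ _ => add_nonneg (Nat.cast_nonneg _) (hs0 k).le
    rw [abs_div, abs_of_pos ((hWpos n).trans_le hWm)]
    calc _ ≤ |∑ k ∈ Finset.range m, z k| / W (M n) :=
          div_le_div_of_nonneg_left (abs_nonneg _) (hWpos n) hWm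
      _ ≤ (|∑ k ∈ Finset.range (M n), z k| +
          ((Z (M (n + 1)) - Z (M n)) + 2 * (W (M (n + 1)) - W (M n)))) / W (M n) :=
          div_le_div_of_nonneg_right hsplit (hWpos n).le
      _ = e n := by
          simp only [he]
          rw [abs_div, abs_of_pos (hWpos n)]; ring
  rw [Metric.tendsto_atTop] at he0 ⊢
  intro ε hε
  obtain ⟨N, hN⟩ := he0 ε hε
  refine ⟨M N, fun m hm => ?_⟩
  obtain ⟨n, h1, h2⟩ := exists_scale_between hM ((hM.monotone (Nat.zero_le N)).trans hm)
  have hnN : N ≤ n := by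
    by_contra hlt
    exact absurd (h2.trans_le (hM.monotone (by omega : n + 1 ≤ N))) (by omega)
  have h3 := hN n hnN
  rw [Real.dist_0_eq_abs] at h3 ⊢
  exact (hbound n m h1 h2).trans_lt ((le_abs_self _).trans_lt h3)

end Scales

theorem sq_integral_le {Y : Type*} [MeasurableSpace Y] {μ : Measure Y} [IsProbabilityMeasure μ]
    {φ : Y → ℝ} (h1 : Integrable φ μ) (h2 : Integrable (fun y => φ y ^ 2) μ) :
    (∫ y, φ y ∂μ) ^ 2 ≤ ∫ y, φ y ^ 2 ∂μ := by
  set c := ∫ y, φ y ∂μ with hc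
  have h : 0 ≤ ∫ y, (φ y - c) ^ 2 ∂μ := integral_nonneg fun _ => sq_nonneg _
  have e : ∀ y, (φ y - c) ^ 2 = φ y ^ 2 - 2 * c * φ y + c ^ 2 := fun y => by ring
  simp only [e] at h
  have i1 : Integrable (fun y => φ y ^ 2 - 2 * c * φ y) μ := h2.sub (h1.const_mul _)
  rw [integral_add i1 (integrable_const _), integral_sub h2 (h1.const_mul _),
    integral_const_mul, ← hc] at h
  simp only [integral_const, probReal_univ, smul_eq_mul, one_mul] at h
  nlinarith

/-! ### Replacing the random weights by their means -/

section Sparse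

variable {b : ℕ → ℕ} {s : ℕ → ℝ}

theorem increment_of_le_one (hb1 : ∀ k, b k ≤ 1) (k j : ℕ) :
    ∑ i ∈ Finset.range k, b i ≤ ∑ i ∈ Finset.range (k + j), b i ∧
      ∑ i ∈ Finset.range (k + j), b i ≤ ∑ i ∈ Finset.range k, b i + j :=
  partialCount_increment (b := fun k (_ : Unit) => b k) (fun k _ => hb1 k) () k j

theorem abs_sub_le_one (hb1 : ∀ k, b k ≤ 1) (hs0 : ∀ k, 0 < s k) (hs1 : ∀ k, s k ≤ 1) (k : ℕ) :
    |(b k : ℝ) - s k| ≤ 1 :=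
  abs_centered_le (b := fun k (_ : Unit) => b k) (fun k _ => hb1 k) (fun k => (hs0 k).le) hs1 () k

theorem sq_sum_correlation_le_corrBound (hb1 : ∀ k, b k ≤ 1) (hs0 : ∀ k, 0 < s k)
    (hs1 : ∀ k, s k ≤ 1) {Y : Type*} [MeasurableSpace Y] {μ : Measure Y} [IsProbabilityMeasure μ]
    {T S : Y → Y} (hT : MeasurePreserving T μ μ) (hS : MeasurePreserving S μ μ)
    (hTS : Function.Commute T S) {f₀ f g : Y → ℝ} (hf₀ : Measurable f₀) (hf₀1 : ∀ y, |f₀ y| ≤ 1)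
    (hf : Measurable f) (hf1 : ∀ y, |f y| ≤ 1) (hg : Measurable g) (hg1 : ∀ y, |g y| ≤ 1)
    (M : ℕ) {H₁ H₂ : ℕ} (hH₁ : 0 < H₁) (hH₂ : 0 < H₂) {lam : ℝ} (hl : 0 < lam) :
    (∑ k ∈ Finset.range M, ((b k : ℝ) - s k) *
      ∫ x, f₀ x * (f (T^[∑ i ∈ Finset.range k, b i] x) * g (S^[k] x)) ∂μ) ^ 2 ≤
      corrBound (fun k => b k - s k) (fun k => ∑ i ∈ Finset.range k, b i) M H₁ H₂ lam := by
  have hy := abs_sub_le_one hb1 hs0 hs1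
  refine le_trans ?_ (integral_sq_le_corrBound hT hS hTS hf hf1 hg hg1 hy
    (increment_of_le_one hb1) M hH₁ hH₂ hl)
  set p : ℕ → ℕ := fun k => ∑ i ∈ Finset.range k, b i
  set y : ℕ → ℝ := fun k => (b k : ℝ) - s k
  have hvm : ∀ k, Measurable fun x => f (T^[p k] x) * g (S^[k] x) := fun k =>
    (hf.comp (hT.iterate _).measurable).mul (hg.comp (hS.iterate _).measurable)
  have hv1 : ∀ k x, |f (T^[p k] x) * g (S^[k] x)| ≤ 1 := fun k x =>
    abs_mul_le_one (hf1 _) (hg1 _)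
  set V : Y → ℝ := fun x => ∑ k ∈ Finset.range M, y k * (f (T^[p k] x) * g (S^[k] x)) with hV
  have hVm : Measurable V := Finset.measurable_fun_sum _ fun k _ => (hvm k).const_mul _
  have hVb : ∀ x, |V x| ≤ M := fun x => by
    refine (Finset.abs_sum_le_sum_abs _ _).trans ?_
    refine (Finset.sum_le_sum fun k _ => abs_mul_le_one (hy k) (hv1 k x)).trans (by simp)
  have e : ∑ k ∈ Finset.range M, y k * ∫ x, f₀ x * (f (T^[p k] x) * g (S^[k] x)) ∂μ =
      ∫ x, f₀ x * V x ∂μ := by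
    have i1 : ∀ k, Integrable (fun x => y k * (f₀ x * (f (T^[p k] x) * g (S^[k] x)))) μ := fun k =>
      integrable_of_abs_le ((hf₀.mul (hvm k)).const_mul _) 1 fun x =>
        abs_mul_le_one (hy k) (abs_mul_le_one (hf₀1 x) (hv1 k x))
    simp only [← integral_const_mul]
    rw [← integral_finsetSum _ fun k _ => i1 k]
    refine integral_congr_ae (ae_of_all _ fun x => ?_)
    simp only [hV, Finset.mul_sum]
    exact Finset.sum_congr rfl fun k _ => by ring
  rw [e]
  have hle : ∀ x, |f₀ x * V x| ≤ |V x| := fun x => by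
    rw [abs_mul]; exact mul_le_of_le_one_left (abs_nonneg _) (hf₀1 x)
  have hsq : ∀ x, (f₀ x * V x) ^ 2 ≤ V x ^ 2 := fun x => sq_le_sq.2 (hle x)
  have hM2 : ∀ x, V x ^ 2 ≤ (M : ℝ) ^ 2 := fun x => by
    rw [← sq_abs]; exact pow_le_pow_left₀ (abs_nonneg _) (hVb x) 2
  have i2 : Integrable (fun x => (f₀ x * V x) ^ 2) μ :=
    integrable_of_abs_le ((hf₀.mul hVm).pow_const 2) ((M : ℝ) ^ 2) fun x => by
      rw [abs_of_nonneg (sq_nonneg _)]; exact (hsq x).trans (hM2 x)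
  have i3 : Integrable (fun x => V x ^ 2) μ :=
    integrable_of_abs_le (hVm.pow_const 2) ((M : ℝ) ^ 2) fun x => by
      rw [abs_of_nonneg (sq_nonneg _)]; exact hM2 x
  exact (sq_integral_le (integrable_of_abs_le (hf₀.mul hVm) M fun x => (hle x).trans (hVb x))
    i2).trans (integral_mono i2 i3 hsq)

theorem tendsto_centered_correlation (hbs : HasSmallCorrelations b s) (hb1 : ∀ k, b k ≤ 1)
    (hsa : Antitone s) (hs0 : ∀ k, 0 < s k) (hs1 : ∀ k, s k ≤ 1)
    {Y : Type*} [MeasurableSpace Y] {μ : Measure Y} [IsProbabilityMeasure μ]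
    {T S : Y → Y} (hT : MeasurePreserving T μ μ) (hS : MeasurePreserving S μ μ)
    (hTS : Function.Commute T S) {f₀ f g : Y → ℝ} (hf₀ : Measurable f₀) (hf₀1 : ∀ y, |f₀ y| ≤ 1)
    (hf : Measurable f) (hf1 : ∀ y, |f y| ≤ 1) (hg : Measurable g) (hg1 : ∀ y, |g y| ≤ 1) :
    Tendsto (fun m => (∑ k ∈ Finset.range m, ((b k : ℝ) - s k) *
      ∫ x, f₀ x * (f (T^[∑ i ∈ Finset.range k, b i] x) * g (S^[k] x)) ∂μ) /
      ∑ k ∈ Finset.range m, s k) atTop (𝓝 0) := by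
  obtain ⟨M, H₁, H₂, lam, hM, hM0, hratio, p1, p2, pl, hR⟩ := hbs
  refine tendsto_sum_div_of_scales (b := b) hsa hs0 hM hM0 hratio (fun k => ?_) ?_ ?_
  · have h1 : |∫ x, f₀ x * (f (T^[∑ i ∈ Finset.range k, b i] x) * g (S^[k] x)) ∂μ| ≤ 1 := by
      have := norm_integral_le_of_norm_le_const (μ := μ) (C := 1)
        (f := fun x => f₀ x * (f (T^[∑ i ∈ Finset.range k, b i] x) * g (S^[k] x)))
        (ae_of_all μ fun x => abs_mul_le_one (hf₀1 _) (abs_mul_le_one (hf1 _) (hg1 _)))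
      simpa using this
    rw [abs_mul]
    refine (mul_le_of_le_one_right (abs_nonneg _) h1).trans ((abs_sub _ _).trans ?_)
    rw [abs_of_nonneg (Nat.cast_nonneg _), abs_of_pos (hs0 k)]
  · exact tendsto_div_zero_of_sq_le
      (fun n => sq_sum_correlation_le_corrBound hb1 hs0 hs1 hT hS hTS hf₀ hf₀1 hf hf1 hg hg1 (M n)
        (p1 n) (p2 n) (pl n)) hR
  -- The one-point system with constant functions turns the correlation bound into a law of large
  -- numbers for `b`.
  · refine tendsto_div_zero_of_sq_le (fun n => ?_) hR
    have := sq_sum_correlation_le_corrBound hb1 hs0 hs1 (μ := Measure.dirac ())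
      (MeasurePreserving.id _) (MeasurePreserving.id _) (Function.Commute.refl id)
      (f₀ := fun _ => 1) (f := fun _ => 1) (g := fun _ => 1) measurable_const (by simp)
      measurable_const (by simp) measurable_const (by simp) (M n) (p1 n) (p2 n) (pl n)
    simpa using this

theorem tendsto_partial_count_div (hbs : HasSmallCorrelations b s) (hb1 : ∀ k, b k ≤ 1)
    (hsa : Antitone s) (hs0 : ∀ k, 0 < s k) (hs1 : ∀ k, s k ≤ 1) :
    Tendsto (fun m => (∑ k ∈ Finset.range m, (b k : ℝ)) / ∑ k ∈ Finset.range m, s k)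
      atTop (𝓝 1) := by
  have h := tendsto_centered_correlation hbs hb1 hsa hs0 hs1 (μ := Measure.dirac ())
    (MeasurePreserving.id _) (MeasurePreserving.id _) (Function.Commute.refl id)
    (f₀ := fun _ => 1) (f := fun _ => 1) (g := fun _ => 1) measurable_const (by simp)
    measurable_const (by simp) measurable_const (by simp)
  have h1 := h.add_const 1
  rw [zero_add] at h1
  refine h1.congr' ?_
  filter_upwards [eventually_gt_atTop 0] with m hm
  have hW := (sum_range_pos hs0 hm).ne'
  rw [div_add_one hW]
  simp

/-! ### Averages along slowly growing sequences -/

/-- Summation by parts. When `b k = 0` the exponent does not move and only the variation of `s`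
enters, which telescopes; when `b k = 1` the loss is at most `s k + s (k+1)`. -/
theorem abs_sum_slow_diff_le (hb1 : ∀ k, b k ≤ 1) (hsa : Antitone s) (hs0 : ∀ k, 0 < s k)
    (hs1 : ∀ k, s k ≤ 1) {β : ℕ → ℕ → ℝ} (hβ : ∀ p k, |β p k| ≤ 1) (M : ℕ) :
    |∑ k ∈ Finset.range M, s k * (β (∑ i ∈ Finset.range k, b i) k -
      β (∑ i ∈ Finset.range k, b i) (k + 1))| ≤ 3 + 2 * ∑ k ∈ Finset.range M, s k * b k := by
  set p : ℕ → ℕ := fun k => ∑ i ∈ Finset.range k, b i with hp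
  have e : ∑ k ∈ Finset.range M, s k * (β (p k) k - β (p k) (k + 1)) =
      (s 0 * β (p 0) 0 - s M * β (p M) M) + ∑ k ∈ Finset.range M,
        (s (k + 1) * β (p (k + 1)) (k + 1) - s k * β (p k) (k + 1)) := by
    rw [← Finset.sum_range_sub' (fun k => s k * β (p k) k), ← Finset.sum_add_distrib]
    exact Finset.sum_congr rfl fun k _ => by ring
  have h1 : ∀ k q j, |s k * β q j| ≤ s k := fun k q j => by
    rw [abs_mul, abs_of_pos (hs0 k)]
    exact mul_le_of_le_one_right (hs0 k).le (hβ _ _)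
  have h2 : ∀ k, |s (k + 1) * β (p (k + 1)) (k + 1) - s k * β (p k) (k + 1)| ≤
      (s k - s (k + 1)) + 2 * (s k * b k) := fun k => by
    have hm := hsa (Nat.le_succ k)
    have hbk := hb1 k
    have hpk : p (k + 1) = p k + b k := Finset.sum_range_succ _ _
    rcases Nat.le_one_iff_eq_zero_or_eq_one.1 hbk with h | h
    · rw [hpk, h, add_zero, ← sub_mul, abs_mul, abs_sub_comm, abs_of_nonneg (sub_nonneg.2 hm)]
      simpa using mul_le_of_le_one_right (sub_nonneg.2 hm) (hβ _ _)
    · refine (abs_sub _ _).trans ((add_le_add (h1 _ _ _) (h1 _ _ _)).trans ?_)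
      rw [h, Nat.cast_one, mul_one]
      have : s (k + 1) ≤ s k := hm
      linarith
  rw [e]
  refine (abs_add_le _ _).trans ?_
  have h3 : |s 0 * β (p 0) 0 - s M * β (p M) M| ≤ 1 + s M :=
    (abs_sub _ _).trans (add_le_add ((h1 _ _ _).trans (hs1 0)) (h1 _ _ _))
  have h4 : |∑ k ∈ Finset.range M, (s (k + 1) * β (p (k + 1)) (k + 1) - s k * β (p k) (k + 1))| ≤
      (s 0 - s M) + 2 * ∑ k ∈ Finset.range M, s k * b k := by
    refine (Finset.abs_sum_le_sum_abs _ _).trans ((Finset.sum_le_sum fun k _ => h2 k).trans ?_)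
    rw [Finset.sum_add_distrib, Finset.sum_range_sub', ← Finset.mul_sum]
  have := hs1 0
  linarith

theorem tendsto_slow_diff (hp : Tendsto (fun m => (∑ k ∈ Finset.range m, (b k : ℝ)) /
      ∑ k ∈ Finset.range m, s k) atTop (𝓝 1)) (hb1 : ∀ k, b k ≤ 1)
    (hsa : Antitone s) (hs0 : ∀ k, 0 < s k) (hs1 : ∀ k, s k ≤ 1) (hst : Tendsto s atTop (𝓝 0))
    (hW : Tendsto (fun m => ∑ k ∈ Finset.range m, s k) atTop atTop)
    {β : ℕ → ℕ → ℝ} (hβ : ∀ p k, |β p k| ≤ 1) :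
    Tendsto (fun m => (∑ k ∈ Finset.range m, s k * (β (∑ i ∈ Finset.range k, b i) k -
      β (∑ i ∈ Finset.range k, b i) (k + 1))) / ∑ k ∈ Finset.range m, s k) atTop (𝓝 0) := by
  have hB : Tendsto (fun m => ∑ k ∈ Finset.range m, (b k : ℝ)) atTop atTop := by
    refine (hp.pos_mul_atTop one_pos hW).congr' ?_
    filter_upwards [eventually_gt_atTop 0] with m hm
    exact div_mul_cancel₀ _ (sum_range_pos hs0 hm).ne'
  -- Since `s → 0`, the sum of `s k * b k` is negligible against that of `b k`, hence against that
  -- of `s k`.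
  have hlo : (fun k => s k * (b k : ℝ)) =o[atTop] fun k => (b k : ℝ) := by
    have h1 : s =o[atTop] fun _ => (1 : ℝ) := (Asymptotics.isLittleO_one_iff ℝ).2 hst
    simpa using h1.mul_isBigO (Asymptotics.isBigO_refl (fun k => (b k : ℝ)) atTop)
  have hsum := (hlo.sum_range (fun k => Nat.cast_nonneg (b k)) hB).tendsto_div_nhds_zero
  have hsb : Tendsto (fun m => (∑ k ∈ Finset.range m, s k * b k) / ∑ k ∈ Finset.range m, s k)
      atTop (𝓝 0) := by
    have h := hsum.mul hp
    rw [zero_mul] at h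
    refine h.congr' ?_
    filter_upwards [hB.eventually_gt_atTop 0] with m hm
    rw [div_mul_div_cancel₀ hm.ne']
  have hbd : Tendsto (fun m => 3 / (∑ k ∈ Finset.range m, s k) +
      2 * ((∑ k ∈ Finset.range m, s k * b k) / ∑ k ∈ Finset.range m, s k)) atTop (𝓝 0) := by
    simpa using (hW.const_div_atTop 3).add (hsb.const_mul 2)
  refine squeeze_zero_norm (fun m => ?_) hbd
  have hWm : 0 ≤ ∑ k ∈ Finset.range m, s k := Finset.sum_nonneg fun k _ => (hs0 k).le
  rw [Real.norm_eq_abs, abs_div, abs_of_nonneg hWm, ← mul_div_assoc, ← add_div]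
  exact div_le_div_of_nonneg_right (abs_sum_slow_diff_le hb1 hsa hs0 hs1 hβ m) hWm

/-- Replacing `k` by `k + h` with `p k` frozen is a sum of `h` unit shifts, each negligible by
`tendsto_slow_diff`. So `β (p k) k` may be averaged over `h < H` before letting `H` grow. -/
theorem tendsto_slow_average (hp : Tendsto (fun m => (∑ k ∈ Finset.range m, (b k : ℝ)) /
      ∑ k ∈ Finset.range m, s k) atTop (𝓝 1)) (hb1 : ∀ k, b k ≤ 1)
    (hsa : Antitone s) (hs0 : ∀ k, 0 < s k) (hs1 : ∀ k, s k ≤ 1) (hst : Tendsto s atTop (𝓝 0))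
    (hW : Tendsto (fun m => ∑ k ∈ Finset.range m, s k) atTop atTop)
    {β : ℕ → ℕ → ℝ} (hβ : ∀ p k, |β p k| ≤ 1) {α : ℕ → ℝ} (hα : Tendsto α atTop (𝓝 0))
    (hβα : ∀ H p k, |(∑ h ∈ Finset.range H, β p (k + h)) / H| ≤ α H) :
    Tendsto (fun m => (∑ k ∈ Finset.range m, s k * β (∑ i ∈ Finset.range k, b i) k) /
      ∑ k ∈ Finset.range m, s k) atTop (𝓝 0) := by
  set p : ℕ → ℕ := fun k => ∑ i ∈ Finset.range k, b i
  set W : ℕ → ℝ := fun m => ∑ k ∈ Finset.range m, s k with hWdef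
  have hW0 : ∀ m, 0 ≤ W m := fun m => Finset.sum_nonneg fun k _ => (hs0 k).le
  have hshift : ∀ h : ℕ, Tendsto (fun m => (∑ k ∈ Finset.range m,
      s k * (β (p k) k - β (p k) (k + h))) / W m) atTop (𝓝 0) := by
    intro h
    induction h with
    | zero => simp
    | succ h ih =>
      have := ih.add (tendsto_slow_diff hp hb1 hsa hs0 hs1 hst hW
        (β := fun p k => β p (k + h)) fun p k => hβ _ _)
      rw [add_zero] at this
      refine this.congr fun m => ?_
      rw [← add_div, ← Finset.sum_add_distrib]
      congr 1
      refine Finset.sum_congr rfl fun k _ => ?_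
      rw [show k + 1 + h = k + (h + 1) by ring]; ring
  rw [Metric.tendsto_atTop]
  intro ε hε
  obtain ⟨H, hH0, hHα⟩ := ((eventually_gt_atTop 0).and
    (hα.eventually (gt_mem_nhds (half_pos hε)))).exists
  have hH : (0 : ℝ) < H := by exact_mod_cast hH0
  have havg : Tendsto (fun m => (∑ h ∈ Finset.range H, (∑ k ∈ Finset.range m,
      s k * (β (p k) k - β (p k) (k + h))) / W m) / H) atTop (𝓝 0) := by
    simpa using (tendsto_finsetSum (Finset.range H) fun h _ => hshift h).div_const (H : ℝ)
  obtain ⟨N, hN⟩ := (Metric.tendsto_atTop.1 havg) (ε / 2) (half_pos hε)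
  refine ⟨N + 1, fun m hm => ?_⟩
  have h1 := hN m (by omega)
  rw [Real.dist_0_eq_abs] at h1 ⊢
  have hWm : 0 < W m := sum_range_pos hs0 (by omega)
  have e : (∑ k ∈ Finset.range m, s k * β (p k) k) / W m =
      (∑ h ∈ Finset.range H, (∑ k ∈ Finset.range m,
        s k * (β (p k) k - β (p k) (k + h))) / W m) / H +
      (∑ k ∈ Finset.range m, s k * ((∑ h ∈ Finset.range H, β (p k) (k + h)) / H)) / W m := by
    have hnum : ∑ k ∈ Finset.range m, s k * β (p k) k =
        (∑ h ∈ Finset.range H, ∑ k ∈ Finset.range m, s k * (β (p k) k - β (p k) (k + h))) / H +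
        ∑ k ∈ Finset.range m, s k * ((∑ h ∈ Finset.range H, β (p k) (k + h)) / H) := by
      rw [Finset.sum_comm, Finset.sum_div, ← Finset.sum_add_distrib]
      refine Finset.sum_congr rfl fun k _ => ?_
      rw [← Finset.mul_sum, Finset.sum_sub_distrib, Finset.sum_const, Finset.card_range,
        nsmul_eq_mul]
      field_simp
      ring
    rw [hnum, add_div, ← Finset.sum_div, div_right_comm]
  have h2 : |(∑ k ∈ Finset.range m, s k * ((∑ h ∈ Finset.range H, β (p k) (k + h)) / H)) / W m| ≤
      α H := by
    rw [abs_div, abs_of_pos hWm, div_le_iff₀ hWm, mul_comm (α H), hWdef, Finset.sum_mul]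
    refine (Finset.abs_sum_le_sum_abs _ _).trans (Finset.sum_le_sum fun k _ => ?_)
    rw [abs_mul, abs_of_pos (hs0 k)]
    exact mul_le_mul_of_nonneg_left (hβα _ _ _) (hs0 k).le
  rw [e]
  refine (abs_add_le _ _).trans_lt ?_
  linarith

/-- If the averages of `g` along `S` tend to zero in `L¹`, then so do the correlations sampled
along `b`. -/
theorem tendsto_sampled_correlation (hbs : HasSmallCorrelations b s) (hb1 : ∀ k, b k ≤ 1)
    (hsa : Antitone s) (hs0 : ∀ k, 0 < s k) (hs1 : ∀ k, s k ≤ 1) (hst : Tendsto s atTop (𝓝 0))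
    (hW : Tendsto (fun m => ∑ k ∈ Finset.range m, s k) atTop atTop)
    {Y : Type*} [MeasurableSpace Y] {μ : Measure Y} [IsProbabilityMeasure μ]
    {T S : Y → Y} (hT : MeasurePreserving T μ μ) (hS : MeasurePreserving S μ μ)
    (hTS : Function.Commute T S) {f₀ f g : Y → ℝ} (hf₀ : Measurable f₀) (hf₀1 : ∀ y, |f₀ y| ≤ 1)
    (hf : Measurable f) (hf1 : ∀ y, |f y| ≤ 1) (hg : Measurable g) (hg1 : ∀ y, |g y| ≤ 1)
    (hgS : Tendsto (fun H : ℕ => ∫ x, |(∑ h ∈ Finset.range H, g (S^[h] x)) / H| ∂μ)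
      atTop (𝓝 0)) :
    Tendsto (fun m => (∑ k ∈ Finset.range m, (b k : ℝ) *
      ∫ x, f₀ x * (f (T^[∑ i ∈ Finset.range k, b i] x) * g (S^[k] x)) ∂μ) /
      ∑ k ∈ Finset.range m, (b k : ℝ)) atTop (𝓝 0) := by
  have hp := tendsto_partial_count_div hbs hb1 hsa hs0 hs1
  set β : ℕ → ℕ → ℝ := fun p k => ∫ x, f₀ x * (f (T^[p] x) * g (S^[k] x)) ∂μ with hβ
  have hfm : ∀ n, Measurable fun x => f (T^[n] x) := fun n => hf.comp (hT.iterate n).measurable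
  have hgm : ∀ n, Measurable fun x => g (S^[n] x) := fun n => hg.comp (hS.iterate n).measurable
  have hint : ∀ p k, Integrable (fun x => f₀ x * (f (T^[p] x) * g (S^[k] x))) μ := fun p k =>
    integrable_of_abs_le (hf₀.mul ((hfm p).mul (hgm k))) 1 fun x =>
      abs_mul_le_one (hf₀1 _) (abs_mul_le_one (hf1 _) (hg1 _))
  have hβ1 : ∀ p k, |β p k| ≤ 1 := fun p k => by
    have := norm_integral_le_of_norm_le_const (μ := μ) (C := 1)
      (f := fun x => f₀ x * (f (T^[p] x) * g (S^[k] x)))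
      (ae_of_all μ fun x => abs_mul_le_one (hf₀1 _) (abs_mul_le_one (hf1 _) (hg1 _)))
    simpa using this
  -- `f₀` and `f ∘ T^p` are bounded by `1` and `S^k` preserves `μ`, so the bound is uniform in `p`
  -- and `k`.
  have hβα : ∀ H p k, |(∑ h ∈ Finset.range H, β p (k + h)) / H| ≤
      ∫ x, |(∑ h ∈ Finset.range H, g (S^[h] x)) / H| ∂μ := by
    intro H p k
    set A : Y → ℝ := fun x => (∑ h ∈ Finset.range H, g (S^[h] x)) / H with hA
    have hAm : Measurable A := (Finset.measurable_fun_sum _ fun h _ => hgm h).div_const _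
    have hAb : ∀ x, |A x| ≤ H / H := fun x => by
      simp only [hA]
      rw [abs_div, Nat.abs_cast]
      refine div_le_div_of_nonneg_right ?_ (Nat.cast_nonneg H)
      exact (Finset.abs_sum_le_sum_abs _ _).trans
        ((Finset.sum_le_sum fun h _ => hg1 _).trans (by simp))
    have e : (∑ h ∈ Finset.range H, β p (k + h)) / H =
        ∫ x, f₀ x * f (T^[p] x) * A (S^[k] x) ∂μ := by
      simp only [hβ]
      rw [← integral_finsetSum _ fun h _ => hint p (k + h), ← integral_div]
      refine integral_congr_ae (ae_of_all _ fun x => ?_)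
      simp only [hA, ← Function.iterate_add_apply, mul_div_assoc', Finset.mul_sum]
      congr 1
      refine Finset.sum_congr rfl fun h _ => ?_
      rw [add_comm h k]; ring
    rw [e]
    have hAS : Integrable (fun x => |A (S^[k] x)|) μ :=
      integrable_of_abs_le (hAm.comp (hS.iterate k).measurable).abs (H / H) fun x => by
        rw [abs_abs]; exact hAb _
    calc _ ≤ ∫ x, |f₀ x * f (T^[p] x) * A (S^[k] x)| ∂μ := abs_integral_le_integral_abs
      _ ≤ ∫ x, |A (S^[k] x)| ∂μ := by
          refine integral_mono_of_nonneg (ae_of_all _ fun x => abs_nonneg _) hAS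
            (ae_of_all _ fun x => ?_)
          simp only [abs_mul (f₀ x * f (T^[p] x))]
          exact mul_le_of_le_one_left (abs_nonneg _) (abs_mul_le_one (hf₀1 _) (hf1 _))
      _ = ∫ x, |A x| ∂μ := by
          have := integral_map (μ := μ) (f := fun x => |A x|)
            (hS.iterate k).measurable.aemeasurable hAm.abs.aestronglyMeasurable
          rw [(hS.iterate k).map_eq] at this
          exact this.symm
  have h1 := tendsto_centered_correlation hbs hb1 hsa hs0 hs1 hT hS hTS hf₀ hf₀1 hf hf1 hg hg1
  have h2 := tendsto_slow_average hp hb1 hsa hs0 hs1 hst hW hβ1 hgS hβα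
  have h3 := (h1.add h2).div hp one_ne_zero
  rw [add_zero, zero_div] at h3
  refine h3.congr' ?_
  filter_upwards [eventually_gt_atTop 0] with m hm
  have hWm := (sum_range_pos hs0 hm).ne'
  simp only [Pi.div_apply]
  rw [← add_div, div_div_div_cancel_right₀ hWm, ← Finset.sum_add_distrib]
  congr 1
  exact Finset.sum_congr rfl fun k _ => by simp only [hβ]; ring

end Sparse

/-! ### The mean ergodic theorem in `L¹` and a lower bound for triple integrals -/

theorem abs_clip_sub_le {x c : ℝ} (h0 : 0 ≤ x) (h1 : x ≤ 1) : |x - max 0 (min 1 c)| ≤ |x - c| := by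
  rcases le_total c 0 with h | h
  · rw [min_eq_right (by linarith), max_eq_left h, abs_of_nonneg (by linarith),
      abs_of_nonneg (by linarith)]
    linarith
  · rcases le_total c 1 with h' | h'
    · rw [min_eq_right h', max_eq_right h]
    · rw [min_eq_left h', max_eq_right zero_le_one, abs_of_nonpos (by linarith),
        abs_of_nonpos (by linarith)]
      linarith

/-- AM-GM for three terms with product `t⁶`. With `p q = r²` and `p + q ≥ 2 r` it reduces to `r (r -
t)² (r + 2 t) ≥ 0`. -/
theorem three_le_amgm {p q t : ℝ} (hp : 0 < p) (hq : 0 < q) (ht : 0 < t) :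
    3 * t ^ 2 ≤ p * q + t ^ 3 * p⁻¹ + t ^ 3 * q⁻¹ := by
  have hpq : 0 < p * q := mul_pos hp hq
  have e : p * q + t ^ 3 * p⁻¹ + t ^ 3 * q⁻¹ = ((p * q) ^ 2 + t ^ 3 * q + t ^ 3 * p) / (p * q) := by
    field_simp
  rw [e, le_div_iff₀ hpq]
  obtain ⟨r, hr0, hr⟩ : ∃ r, 0 < r ∧ p * q = r ^ 2 :=
    ⟨Real.sqrt (p * q), Real.sqrt_pos.2 hpq, (Real.sq_sqrt hpq.le).symm⟩
  have hsum : 2 * r ≤ p + q := by nlinarith [sq_nonneg (p - q)]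
  rw [hr]
  have h2 : t ^ 3 * (2 * r) ≤ t ^ 3 * (p + q) := by gcongr
  have h3 : 0 ≤ r * ((r - t) ^ 2 * (r + 2 * t)) := by positivity
  nlinarith

theorem abs_average_le_one {Y : Type*} {f : Y → ℝ} (hf1 : ∀ y, |f y| ≤ 1) (T : Y → Y) (N : ℕ) (y : Y) :
    |(∑ n ∈ Finset.range N, f (T^[n] y)) / N| ≤ 1 := by
  rw [abs_div, Nat.abs_cast]
  exact div_le_one_of_le₀ ((Finset.abs_sum_le_sum_abs _ _).trans
    ((Finset.sum_le_sum fun n _ => hf1 _).trans (by simp))) (Nat.cast_nonneg _)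

section MeanErgodic

variable {Y : Type*} [MeasurableSpace Y] {μ : Measure Y}

theorem integral_comp_eq {T : Y → Y} (hT : MeasurePreserving T μ μ) {f : Y → ℝ}
    (hf : Measurable f) : ∫ y, f (T y) ∂μ = ∫ y, f y ∂μ := by
  have := integral_map (μ := μ) (f := f) hT.measurable.aemeasurable hf.aestronglyMeasurable
  rw [hT.map_eq] at this
  exact this.symm

theorem ae_eq_comp_iterate {T : Y → Y} (hT : MeasurePreserving T μ μ) {h : Y → ℝ}
    (hh : h ∘ T =ᵐ[μ] h) (n : ℕ) : h ∘ T^[n] =ᵐ[μ] h := by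
  induction n with
  | zero => simp
  | succ n ih =>
    rw [Function.iterate_succ, ← Function.comp_assoc]
    exact (hT.quasiMeasurePreserving.ae_eq_comp ih).trans hh

variable [IsProbabilityMeasure μ]

theorem integral_abs_le_norm (g : Lp ℝ 2 μ) : ∫ y, |g y| ∂μ ≤ ‖g‖ := by
  have hg : MemLp g 2 μ := Lp.memLp g
  have h1 : Integrable (fun y => |g y|) μ := (hg.integrable one_le_two).abs
  have h2 : Integrable (fun y => |g y| ^ 2) μ := by simpa using hg.integrable_sq
  have h3 := sq_integral_le h1 h2
  have h4 : ∫ y, |g y| ^ 2 ∂μ = ‖g‖ ^ 2 := by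
    rw [← real_inner_self_eq_norm_sq, L2.inner_def]
    refine integral_congr_ae (ae_of_all _ fun y => ?_)
    simp [sq]
  rw [h4] at h3
  exact (abs_le_of_sq_le_sq' h3 (norm_nonneg _)).2

/-- The Birkhoff averages of a `[0, 1]`-valued function converge in `L¹` to an invariant function. -/
theorem exists_invariant_limit {T : Y → Y} (hT : MeasurePreserving T μ μ) {f : Y → ℝ}
    (hf : Measurable f) (hf0 : ∀ y, 0 ≤ f y) (hf1 : ∀ y, f y ≤ 1) :
    ∃ F : Y → ℝ, Measurable F ∧ (∀ y, 0 ≤ F y) ∧ (∀ y, F y ≤ 1) ∧ F ∘ T =ᵐ[μ] F ∧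
      Tendsto (fun N : ℕ => ∫ y, |(∑ n ∈ Finset.range N, f (T^[n] y)) / N - F y| ∂μ)
        atTop (𝓝 0) := by
  have hfL : MemLp f 2 μ := MemLp.of_bound hf.aestronglyMeasurable 1
    (ae_of_all _ fun y => by rw [Real.norm_eq_abs, abs_of_nonneg (hf0 y)]; exact hf1 y)
  set φ : Lp ℝ 2 μ := hfL.toLp f with hφ
  set U : Lp ℝ 2 μ →L[ℝ] Lp ℝ 2 μ :=
    (Lp.compMeasurePreservingₗᵢ ℝ T hT).toContinuousLinearMap with hU
  have hUapp : ∀ g : Lp ℝ 2 μ, U g = Lp.compMeasurePreserving T hT g := fun g => rfl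
  have hU1 : ‖U‖ ≤ 1 := LinearIsometry.norm_toContinuousLinearMap_le _
  have hlim := U.tendsto_birkhoffAverage_orthogonalProjection hU1 φ
  set G : Lp ℝ 2 μ := ((U.eqLocus (1 : Lp ℝ 2 μ →L[ℝ] Lp ℝ 2 μ)).orthogonalProjectionOnto φ :
    Lp ℝ 2 μ) with hG
  have hGU : U G = G := by
    have : G ∈ U.eqLocus (1 : Lp ℝ 2 μ →L[ℝ] Lp ℝ 2 μ) := Subtype.coe_prop _
    simpa using this
  obtain ⟨G', hG'm, hG'⟩ : ∃ G' : Y → ℝ, Measurable G' ∧ G =ᵐ[μ] G' :=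
    ⟨_, (Lp.aestronglyMeasurable G).stronglyMeasurable_mk.measurable,
      (Lp.aestronglyMeasurable G).ae_eq_mk⟩
  have hinv : G' ∘ T =ᵐ[μ] G' := by
    have h1 : U G =ᵐ[μ] G ∘ T := Lp.coeFn_compMeasurePreserving G hT
    rw [hGU] at h1
    exact ((hT.quasiMeasurePreserving.ae_eq_comp hG').symm.trans h1.symm).trans hG'
  have hiter : ∀ n, (U^[n] φ : Lp ℝ 2 μ) =ᵐ[μ] fun y => f (T^[n] y) := fun n => by
    have h1 : U^[n] φ = Lp.compMeasurePreserving T^[n] (hT.iterate n) φ := by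
      rw [← Lp.compMeasurePreserving_iterate hT n]; rfl
    rw [h1]
    exact (Lp.coeFn_compMeasurePreserving φ (hT.iterate n)).trans
      ((hT.iterate n).quasiMeasurePreserving.ae_eq_comp hfL.coeFn_toLp)
  have hnorm : Tendsto (fun N => ‖birkhoffAverage ℝ U _root_.id N φ - G‖) atTop (𝓝 0) :=
    tendsto_iff_norm_sub_tendsto_zero.1 hlim
  have havg : ∀ N, (birkhoffAverage ℝ U _root_.id N φ - G : Lp ℝ 2 μ) =ᵐ[μ]
      fun y => (∑ n ∈ Finset.range N, f (T^[n] y)) / N - G' y := fun N => by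
    have hs : (∑ n ∈ Finset.range N, U^[n] φ : Lp ℝ 2 μ) =ᵐ[μ]
        fun y => ∑ n ∈ Finset.range N, f (T^[n] y) := by
      induction N with
      | zero =>
        simp only [Finset.range_zero, Finset.sum_empty]
        exact Lp.coeFn_zero ℝ 2 μ
      | succ N ih =>
        rw [Finset.sum_range_succ]
        filter_upwards [Lp.coeFn_add (∑ n ∈ Finset.range N, U^[n] φ) (U^[N] φ), ih, hiter N]
          with y h1 h2 h3
        rw [h1, Pi.add_apply, h2, h3, Finset.sum_range_succ]
    have hb : birkhoffAverage ℝ U _root_.id N φ =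
        (N : ℝ)⁻¹ • (∑ n ∈ Finset.range N, U^[n] φ : Lp ℝ 2 μ) := rfl
    rw [hb]
    filter_upwards [Lp.coeFn_sub ((N : ℝ)⁻¹ • (∑ n ∈ Finset.range N, U^[n] φ : Lp ℝ 2 μ)) G,
      Lp.coeFn_smul ((N : ℝ)⁻¹) (∑ n ∈ Finset.range N, U^[n] φ : Lp ℝ 2 μ), hs, hG']
      with y h1 h2 h3 h4
    rw [h1, Pi.sub_apply, h2, Pi.smul_apply, h3, h4, smul_eq_mul, div_eq_inv_mul]
  -- The `L²` limit is an a.e. class; clipping a representative to `[0, 1]` gives pointwise bounds,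
  -- keeps invariance, and does not increase the distance to averages already in `[0, 1]`.
  refine ⟨fun y => max 0 (min 1 (G' y)), measurable_const.max (measurable_const.min hG'm),
    fun y => le_max_left _ _, fun y => max_le zero_le_one (min_le_left _ _), ?_, ?_⟩
  · filter_upwards [hinv] with y hy
    simp only [Function.comp_apply] at hy ⊢
    rw [hy]
  · refine squeeze_zero (fun N => integral_nonneg fun _ => abs_nonneg _) (fun N => ?_) hnorm
    refine le_trans ?_ (integral_abs_le_norm _)
    have hi : Integrable (fun y => |(birkhoffAverage ℝ U _root_.id N φ - G : Lp ℝ 2 μ) y|) μ :=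
      ((Lp.memLp _).integrable one_le_two).abs
    refine integral_mono_of_nonneg (ae_of_all _ fun y => abs_nonneg _) hi ?_
    filter_upwards [havg N] with y hy
    rw [hy]
    have h0 : 0 ≤ (∑ n ∈ Finset.range N, f (T^[n] y)) / N :=
      div_nonneg (Finset.sum_nonneg fun n _ => hf0 _) (Nat.cast_nonneg _)
    have h1 : (∑ n ∈ Finset.range N, f (T^[n] y)) / N ≤ 1 :=
      div_le_one_of_le₀ ((Finset.sum_le_sum fun n _ => hf1 _).trans (by simp)) (Nat.cast_nonneg _)
    exact abs_clip_sub_le h0 h1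

/-- `F` acts as the conditional expectation of `f` on the invariant sets: against an invariant `h`,
every iterate of `f` has the same integral, so the averages do too, and they converge to `F` in
`L¹`. -/
theorem integral_mul_invariant {T : Y → Y} (hT : MeasurePreserving T μ μ) {f F : Y → ℝ}
    (hf : Measurable f) (hf1 : ∀ y, |f y| ≤ 1) (hF : Measurable F) (hF1 : ∀ y, |F y| ≤ 1)
    (hlim : Tendsto (fun N : ℕ => ∫ y, |(∑ n ∈ Finset.range N, f (T^[n] y)) / N - F y| ∂μ)
        atTop (𝓝 0))
    {h : Y → ℝ} (hh : Measurable h) {C : ℝ} (hC : ∀ y, |h y| ≤ C) (hinv : h ∘ T =ᵐ[μ] h) :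
    ∫ y, f y * h y ∂μ = ∫ y, F y * h y ∂μ := by
  have hfm : ∀ n, Measurable fun y => f (T^[n] y) := fun n => hf.comp (hT.iterate n).measurable
  have hi : ∀ {g : Y → ℝ}, Measurable g → (∀ y, |g y| ≤ 1) → Integrable (fun y => g y * h y) μ :=
    fun hg hg1 => integrable_of_abs_le (hg.mul hh) C fun y => by
      rw [abs_mul]
      exact (mul_le_of_le_one_left (abs_nonneg _) (hg1 y)).trans (hC y)
  set A : ℕ → Y → ℝ := fun N y => (∑ n ∈ Finset.range N, f (T^[n] y)) / N with hA
  have hAm : ∀ N, Measurable (A N) := fun N =>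
    (Finset.measurable_fun_sum _ fun n _ => hfm n).div_const _
  have hA1 : ∀ N y, |A N y| ≤ 1 := fun N y => abs_average_le_one hf1 T N y
  have hn : ∀ n, ∫ y, f (T^[n] y) * h y ∂μ = ∫ y, f y * h y ∂μ := fun n => by
    rw [← integral_comp_eq (hT.iterate n) (f := fun y => f y * h y) (hf.mul hh)]
    refine integral_congr_ae ?_
    filter_upwards [ae_eq_comp_iterate hT hinv n] with y hy
    rw [Function.comp_apply] at hy
    rw [hy]
  have hconst : ∀ N, 0 < N → ∫ y, A N y * h y ∂μ = ∫ y, f y * h y ∂μ := fun N hN => by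
    have hN0 : (N : ℝ) ≠ 0 := by exact_mod_cast hN.ne'
    simp only [hA, div_mul_eq_mul_div, Finset.sum_mul]
    rw [integral_div, integral_finsetSum _ fun n _ => hi (hfm n) fun y => hf1 _]
    simp only [hn, Finset.sum_const, Finset.card_range, nsmul_eq_mul]
    exact mul_div_cancel_left₀ _ hN0
  have hconv : Tendsto (fun N => ∫ y, A N y * h y ∂μ - ∫ y, F y * h y ∂μ) atTop (𝓝 0) := by
    refine squeeze_zero_norm (fun N => ?_) (by simpa using hlim.mul_const C)
    rw [← integral_sub (hi (hAm N) (hA1 N)) (hi hF hF1), Real.norm_eq_abs, ← integral_mul_const]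
    refine abs_integral_le_integral_abs.trans (integral_mono_of_nonneg
      (ae_of_all _ fun y => abs_nonneg _) ?_ (ae_of_all _ fun y => ?_))
    · exact (integrable_of_abs_le ((hAm N).sub hF).abs 2 fun y => by
        rw [abs_abs]
        refine (abs_sub _ _).trans ?_
        linarith [hA1 N y, hF1 y]).mul_const C
    · simp only [← sub_mul, abs_mul]
      exact mul_le_mul_of_nonneg_left (hC y) (abs_nonneg _)
  have h1 : Tendsto (fun _ : ℕ => ∫ y, f y * h y ∂μ - ∫ y, F y * h y ∂μ) atTop (𝓝 0) := by
    refine hconv.congr' ?_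
    filter_upwards [eventually_gt_atTop 0] with N hN
    rw [hconst N hN]
  have := tendsto_nhds_unique h1 tendsto_const_nhds
  linarith

/-- `(F + ε)⁻¹` is invariant, so `f` may be replaced by `F`. The `ε` guards against zeros of `F`. -/
theorem integral_div_le_one {T : Y → Y} (hT : MeasurePreserving T μ μ) {f F : Y → ℝ}
    (hf : Measurable f) (hf1 : ∀ y, |f y| ≤ 1) (hF : Measurable F) (hF0 : ∀ y, 0 ≤ F y)
    (hF1 : ∀ y, F y ≤ 1) (hinv : F ∘ T =ᵐ[μ] F)
    (hlim : Tendsto (fun N : ℕ => ∫ y, |(∑ n ∈ Finset.range N, f (T^[n] y)) / N - F y| ∂μ)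
        atTop (𝓝 0)) {ε : ℝ} (hε : 0 < ε) :
    ∫ y, f y * (F y + ε)⁻¹ ∂μ ≤ 1 := by
  have hF1' : ∀ y, |F y| ≤ 1 := fun y => by rw [abs_of_nonneg (hF0 y)]; exact hF1 y
  have hm : Measurable fun y => (F y + ε)⁻¹ := (hF.add_const ε).inv
  have hb : ∀ y, |(F y + ε)⁻¹| ≤ ε⁻¹ := fun y => by
    have := hF0 y
    rw [abs_of_nonneg (by positivity)]
    exact inv_anti₀ hε (by linarith)
  rw [integral_mul_invariant hT hf hf1 hF hF1' hlim hm hb (by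
    filter_upwards [hinv] with y hy
    simp only [Function.comp_apply] at hy ⊢
    rw [hy])]
  have : ∀ y, F y * (F y + ε)⁻¹ ≤ 1 := fun y => by
    have := hF0 y
    rw [← div_eq_mul_inv]
    exact div_le_one_of_le₀ (by linarith) (by linarith)
  calc _ ≤ ∫ _, (1 : ℝ) ∂μ := integral_mono_of_nonneg
        (ae_of_all _ fun y => mul_nonneg (hF0 y) (inv_nonneg.2 (by have := hF0 y; linarith)))
        (integrable_const _) (ae_of_all _ this)
    _ = 1 := by simp

/-- If `F` and `G` are the limits of the averages of `f ≥ 0` under two transformations, then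
`∫ f F G ≥ (∫ f)³`. -/
theorem integral_pow_three_le {T S : Y → Y} (hT : MeasurePreserving T μ μ)
    (hS : MeasurePreserving S μ μ) {f F G : Y → ℝ}
    (hf : Measurable f) (hf0 : ∀ y, 0 ≤ f y) (hf1 : ∀ y, f y ≤ 1)
    (hF : Measurable F) (hF0 : ∀ y, 0 ≤ F y) (hF1 : ∀ y, F y ≤ 1) (hFT : F ∘ T =ᵐ[μ] F)
    (hFlim : Tendsto (fun N : ℕ => ∫ y, |(∑ n ∈ Finset.range N, f (T^[n] y)) / N - F y| ∂μ)
        atTop (𝓝 0))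
    (hG : Measurable G) (hG0 : ∀ y, 0 ≤ G y) (hG1 : ∀ y, G y ≤ 1) (hGS : G ∘ S =ᵐ[μ] G)
    (hGlim : Tendsto (fun N : ℕ => ∫ y, |(∑ n ∈ Finset.range N, f (S^[n] y)) / N - G y| ∂μ)
        atTop (𝓝 0)) :
    (∫ y, f y ∂μ) ^ 3 ≤ ∫ y, f y * F y * G y ∂μ := by
  have hfa : ∀ y, |f y| ≤ 1 := fun y => by rw [abs_of_nonneg (hf0 y)]; exact hf1 y
  set t := ∫ y, f y ∂μ with ht
  set I := ∫ y, f y * F y * G y ∂μ with hI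
  have ht0 : 0 ≤ t := integral_nonneg hf0
  have hI0 : 0 ≤ I := integral_nonneg fun y => mul_nonneg (mul_nonneg (hf0 y) (hF0 y)) (hG0 y)
  rcases ht0.eq_or_lt with h0 | htpos
  · rw [← h0]; simpa using hI0
  have hfi : Integrable f μ := integrable_of_abs_le hf 1 hfa
  -- Multiply `three_le_amgm` with `p = F + ε`, `q = G + ε`, `t = ∫ f` by `f` and integrate: `3 t³ ≤
  -- I + 3 ε + t³ + t³`.
  have key : ∀ ε : ℝ, 0 < ε → ε ≤ 1 → t ^ 3 ≤ I + 3 * ε := by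
    intro ε hε hε1
    have hp : ∀ y, 0 < F y + ε := fun y => by linarith [hF0 y]
    have hq : ∀ y, 0 < G y + ε := fun y => by linarith [hG0 y]
    have hpt : ∀ y, 3 * t ^ 2 * f y ≤ f y * F y * G y + 3 * ε +
        t ^ 3 * (f y * (F y + ε)⁻¹) + t ^ 3 * (f y * (G y + ε)⁻¹) := fun y => by
      have h1 := mul_le_mul_of_nonneg_left (three_le_amgm (hp y) (hq y) htpos) (hf0 y)
      have h2 : f y * ((F y + ε) * (G y + ε)) ≤ f y * F y * G y + 3 * ε := by
        have h3 : f y * (F y + G y + ε) ≤ 3 := by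
          have := hF1 y; have := hG1 y; have := hF0 y; have := hG0 y
          calc _ ≤ 1 * (F y + G y + ε) := mul_le_mul_of_nonneg_right (hf1 y) (by linarith)
            _ ≤ 3 := by linarith
        nlinarith
      nlinarith
    have i1 : Integrable (fun y => f y * F y * G y) μ :=
      integrable_of_abs_le ((hf.mul hF).mul hG) 1 fun y =>
        abs_mul_le_one (abs_mul_le_one (hfa y) (by rw [abs_of_nonneg (hF0 y)]; exact hF1 y))
          (by rw [abs_of_nonneg (hG0 y)]; exact hG1 y)
    have hinv : ∀ {K : Y → ℝ}, Measurable K → (∀ y, 0 ≤ K y) →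
        Integrable (fun y => f y * (K y + ε)⁻¹) μ := fun {K} hK hK0 =>
      integrable_of_abs_le (hf.mul (hK.add_const ε).inv) ε⁻¹ fun y => by
        have h1 := hK0 y
        rw [abs_mul, abs_of_nonneg (show 0 ≤ (K y + ε)⁻¹ by positivity)]
        exact (mul_le_of_le_one_left (by positivity) (hfa y)).trans (inv_anti₀ hε (by linarith))
    have i2 := hinv hF hF0
    have i3 := hinv hG hG0
    have i4 : Integrable (fun y => f y * F y * G y + 3 * ε) μ := i1.add (integrable_const _)
    have i5 : Integrable (fun y => f y * F y * G y + 3 * ε + t ^ 3 * (f y * (F y + ε)⁻¹)) μ :=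
      i4.add (i2.const_mul _)
    have hmono := integral_mono (hfi.const_mul (3 * t ^ 2)) (i5.add (i3.const_mul (t ^ 3))) hpt
    simp only [Pi.add_apply] at hmono
    rw [integral_add i5 (i3.const_mul _), integral_add i4 (i2.const_mul _),
      integral_add i1 (integrable_const _), ← hI] at hmono
    simp only [integral_const_mul, integral_const, ← ht, probReal_univ, smul_eq_mul, one_mul] at hmono
    have h1 := integral_div_le_one hT hf hfa hF hF0 hF1 hFT hFlim hε
    have h2 := integral_div_le_one hS hf hfa hG hG0 hG1 hGS hGlim hε
    have ht3 : 0 ≤ t ^ 3 := by positivity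
    have h4 := mul_le_mul_of_nonneg_left h1 ht3
    have h5 := mul_le_mul_of_nonneg_left h2 ht3
    nlinarith
  refine le_of_forall_pos_le_add fun δ hδ => ?_
  have := key (min 1 (δ / 3)) (lt_min one_pos (by linarith)) (min_le_left _ _)
  linarith [min_le_right 1 (δ / 3)]

end MeanErgodic

/-! ### Triple averages along the random sequence -/

/-- A selected `k` is the `j`-th one (from `0`) exactly for `j = Nat.count q k`, so a sum along the
sequence becomes a weighted sum over all `k`. -/
theorem sum_range_count_nth (q : ℕ → Prop) [DecidablePred q] (φ : ℕ → ℕ → ℝ) (M : ℕ) :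
    ∑ j ∈ Finset.range (Nat.count q M), φ j (Nat.nth q j) =
      ∑ k ∈ Finset.range M, if q k then φ (Nat.count q k) k else 0 := by
  induction M with
  | zero => simp
  | succ M ih =>
    rw [Finset.sum_range_succ, ← ih, Nat.count_succ]
    split_ifs with h
    · rw [Finset.sum_range_succ, Nat.nth_count h]
    · rw [add_zero, add_zero]

theorem sum_range_ite_eq_count (q : ℕ → Prop) [DecidablePred q] (M : ℕ) :
    ∑ k ∈ Finset.range M, (if q k then 1 else 0) = Nat.count q M := by
  rw [Nat.count_eq_card_filter_range, Finset.card_filter]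

theorem measureReal_inter_eq_integral {Y : Type*} [MeasurableSpace Y] {μ : Measure Y}
    {A B C : Set Y} (hA : MeasurableSet A) (hB : MeasurableSet B)
    (hC : MeasurableSet C) : μ.real (A ∩ B ∩ C) =
      ∫ y, A.indicator 1 y * (B.indicator 1 y * C.indicator (1 : Y → ℝ) y) ∂μ := by
  have e : ∀ y, A.indicator 1 y * (B.indicator 1 y * C.indicator (1 : Y → ℝ) y) =
      (A ∩ B ∩ C).indicator 1 y := fun y => by
    rw [Set.inter_indicator_one, Set.inter_indicator_one]
    simp only [Pi.mul_apply, mul_assoc]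
  simp only [e]
  rw [integral_indicator_one ((hA.inter hB).inter hC)]

section Triple

variable {b : ℕ → ℕ} {s : ℕ → ℝ} {Y : Type*} [MeasurableSpace Y] {μ : Measure Y} {T S : Y → Y}

theorem tendsto_integral_abs_average_sub_comp (hS : MeasurePreserving S μ μ) {f G : Y → ℝ}
    (hf : Measurable f) (hG : Measurable G) (hGS : G ∘ S =ᵐ[μ] G)
    (hGlim : Tendsto (fun N : ℕ => ∫ y, |(∑ n ∈ Finset.range N, f (S^[n] y)) / N - G y| ∂μ)
        atTop (𝓝 0)) :
    Tendsto (fun H : ℕ => ∫ x, |(∑ h ∈ Finset.range H, (f (S (S^[h] x)) - G (S (S^[h] x)))) / H| ∂μ)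
      atTop (𝓝 0) := by
  refine hGlim.congr' ?_
  filter_upwards [eventually_gt_atTop 0] with H hH
  have hH0 : (H : ℝ) ≠ 0 := by exact_mod_cast hH.ne'
  have hm : Measurable fun y => |(∑ n ∈ Finset.range H, f (S^[n] y)) / H - G y| :=
    (((Finset.measurable_fun_sum _ fun n _ =>
      hf.comp (hS.iterate n).measurable).div_const _).sub hG).abs
  rw [← integral_comp_eq hS hm]
  refine integral_congr_ae ?_
  filter_upwards [ae_all_iff.2 fun n => ae_eq_comp_iterate hS hGS n] with x hx
  have h1 : ∀ h, G (S (S^[h] x)) = G (S x) := fun h => by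
    have h2 := hx (h + 1)
    have h3 := hx 1
    rw [Function.iterate_succ'] at h2
    simp only [Function.comp_apply, Function.iterate_one] at h2 h3
    rw [h2, h3]
  simp only [h1, Finset.sum_sub_distrib, Finset.sum_const, Finset.card_range, nsmul_eq_mul]
  rw [sub_div, mul_div_cancel_left₀ _ hH0]
  simp only [← Function.iterate_succ_apply, ← Function.iterate_succ_apply']

variable [IsProbabilityMeasure μ]

theorem tendsto_integral_average_mul (hT : MeasurePreserving T μ μ) {f F g : Y → ℝ}
    (hf : Measurable f) (hf1 : ∀ y, |f y| ≤ 1) (hF : Measurable F) (hF1 : ∀ y, |F y| ≤ 1)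
    (hFT : F ∘ T =ᵐ[μ] F)
    (hlim : Tendsto (fun N : ℕ => ∫ y, |(∑ n ∈ Finset.range N, f (T^[n] y)) / N - F y| ∂μ)
        atTop (𝓝 0)) (hg : Measurable g) (hg1 : ∀ y, |g y| ≤ 1) :
    Tendsto (fun N : ℕ => (∑ j ∈ Finset.range N, ∫ y, f (T^[j + 1] y) * g y ∂μ) / N) atTop
      (𝓝 (∫ y, F y * g y ∂μ)) := by
  have hfm : ∀ n, Measurable fun y => f (T^[n] y) := fun n => hf.comp (hT.iterate n).measurable
  set A : ℕ → Y → ℝ := fun N y => (∑ n ∈ Finset.range N, f (T^[n] y)) / N with hA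
  have hAm : ∀ N, Measurable (A N) := fun N =>
    (Finset.measurable_fun_sum _ fun n _ => hfm n).div_const _
  have hA1 : ∀ N y, |A N y| ≤ 1 := fun N y => abs_average_le_one hf1 T N y
  have e : ∀ N : ℕ, (∑ j ∈ Finset.range N, ∫ y, f (T^[j + 1] y) * g y ∂μ) / N =
      ∫ y, A N (T y) * g y ∂μ := fun N => by
    rw [← integral_finsetSum _ fun j _ => show Integrable (fun y => f (T^[j + 1] y) * g y) μ from
      integrable_of_abs_le ((hfm _).mul hg) 1 fun y => abs_mul_le_one (hf1 _) (hg1 _),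
      ← integral_div]
    refine integral_congr_ae (ae_of_all _ fun y => ?_)
    simp only [hA, ← Function.iterate_succ_apply, Finset.sum_mul, div_mul_eq_mul_div,
      Nat.succ_eq_add_one]
  have e2 : ∫ y, F y * g y ∂μ = ∫ y, F (T y) * g y ∂μ := integral_congr_ae (by
    filter_upwards [hFT] with y hy
    simp only [Function.comp_apply] at hy
    rw [hy])
  simp only [e, e2]
  rw [tendsto_iff_norm_sub_tendsto_zero]
  refine squeeze_zero (fun _ => norm_nonneg _) (fun N => ?_) hlim
  have hd : Measurable fun y => |A N y - F y| := ((hAm N).sub hF).abs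
  have i1 : Integrable (fun y => A N (T y) * g y) μ :=
    integrable_of_abs_le (((hAm N).comp hT.measurable).mul hg) 1 fun y =>
      abs_mul_le_one (hA1 _ _) (hg1 _)
  have i2 : Integrable (fun y => F (T y) * g y) μ :=
    integrable_of_abs_le ((hF.comp hT.measurable).mul hg) 1 fun y =>
      abs_mul_le_one (hF1 _) (hg1 _)
  rw [← integral_sub i1 i2, Real.norm_eq_abs, ← integral_comp_eq hT hd]
  refine abs_integral_le_integral_abs.trans (integral_mono_of_nonneg
    (ae_of_all _ fun y => abs_nonneg _) ?_ (ae_of_all _ fun y => ?_))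
  · exact integrable_of_abs_le (hd.comp hT.measurable) 2 fun y => by
      simp only [abs_abs]
      refine (abs_sub _ _).trans ?_
      linarith [hA1 N (T y), hF1 (T y)]
  · simp only [← sub_mul, abs_mul]
    exact mul_le_of_le_one_right (abs_nonneg _) (hg1 y)

theorem exists_tendsto_triple_average (hbs : HasSmallCorrelations b s) {q : ℕ → Prop}
    [DecidablePred q] (hq : ∀ k, b k = if q k then 1 else 0)
    (hsa : Antitone s) (hs0 : ∀ k, 0 < s k) (hs1 : ∀ k, s k ≤ 1) (hst : Tendsto s atTop (𝓝 0))
    (hW : Tendsto (fun m => ∑ k ∈ Finset.range m, s k) atTop atTop)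
    (hinf : (Set.ofPred q).Infinite)
    (hT : MeasurePreserving T μ μ) (hS : MeasurePreserving S μ μ) (hTS : Function.Commute T S)
    {f : Y → ℝ} (hf : Measurable f) (hf0 : ∀ y, 0 ≤ f y) (hf1 : ∀ y, f y ≤ 1) :
    ∃ L : ℝ, Tendsto (fun N : ℕ => (∑ j ∈ Finset.range N,
      ∫ y, f y * (f (T^[j + 1] y) * f (S^[Nat.nth q j + 1] y)) ∂μ) / N) atTop (𝓝 L) ∧
      (∫ y, f y ∂μ) ^ 3 ≤ L := by
  obtain ⟨F, hF, hF0, hF1, hFT, hFlim⟩ := exists_invariant_limit hT hf hf0 hf1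
  obtain ⟨G, hG, hG0, hG1, hGS, hGlim⟩ := exists_invariant_limit hS hf hf0 hf1
  have hb1 : ∀ k, b k ≤ 1 := fun k => by rw [hq k]; split_ifs <;> simp
  have hfa : ∀ y, |f y| ≤ 1 := fun y => by rw [abs_of_nonneg (hf0 y)]; exact hf1 y
  have hFa : ∀ y, |F y| ≤ 1 := fun y => by rw [abs_of_nonneg (hF0 y)]; exact hF1 y
  have hGa : ∀ y, |G y| ≤ 1 := fun y => by rw [abs_of_nonneg (hG0 y)]; exact hG1 y
  have hua : ∀ y, |f y - G y| ≤ 1 := fun y => abs_le.2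
    ⟨by linarith [hf0 y, hG1 y], by linarith [hf1 y, hG0 y]⟩
  refine ⟨∫ y, f y * F y * G y ∂μ, ?_,
    integral_pow_three_le hT hS hf hf0 hf1 hF hF0 hF1 hFT hFlim hG hG0 hG1 hGS hGlim⟩
  have hmain := tendsto_integral_average_mul hT hf hfa hF hFa hFT hFlim (hf.mul hG)
    fun y => abs_mul_le_one (hfa y) (hGa y)
  -- Using `f ∘ T` and `(f - G) ∘ S` absorbs the shift by one in both exponents `j + 1` and `Nat.nth
  -- q j + 1`.
  have herr := tendsto_sampled_correlation hbs hb1 hsa hs0 hs1 hst hW hT hS hTS hf hfa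
    (f := fun y => f (T y)) (hf.comp hT.measurable) (fun y => hfa _)
    (g := fun y => f (S y) - G (S y)) ((hf.comp hS.measurable).sub (hG.comp hS.measurable))
    (fun y => hua _) (tendsto_integral_abs_average_sub_comp hS hf hG hGS hGlim)
  -- At the cutoff `m = Nat.nth q N` exactly `N` indices have been selected, so the normalisation
  -- becomes `N`.
  have herr' := herr.comp (Nat.nth_strictMono hinf).tendsto_atTop
  have hadd := hmain.add herr'
  rw [add_zero] at hadd
  have hL : ∫ y, f y * F y * G y ∂μ = ∫ y, F y * (f y * G y) ∂μ :=
    integral_congr_ae (ae_of_all _ fun y => by ring)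
  rw [hL]
  refine hadd.congr fun N => ?_
  have hcount : ∀ k, ∑ i ∈ Finset.range k, b i = Nat.count q k := fun k => by
    rw [← sum_range_ite_eq_count q k]
    exact Finset.sum_congr rfl fun i _ => hq i
  have hN : Nat.count q (Nat.nth q N) = N := Nat.count_nth_of_infinite hinf N
  have hden : ∑ k ∈ Finset.range (Nat.nth q N), (b k : ℝ) = N := by
    rw [← Nat.cast_sum, hcount, hN]
  have hnum : ∑ k ∈ Finset.range (Nat.nth q N), (b k : ℝ) *
      ∫ x, f x * (f (T (T^[∑ i ∈ Finset.range k, b i] x)) *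
        (f (S (S^[k] x)) - G (S (S^[k] x)))) ∂μ =
      ∑ j ∈ Finset.range N, ∫ x, f x * (f (T (T^[j] x)) *
        (f (S (S^[Nat.nth q j] x)) - G (S (S^[Nat.nth q j] x)))) ∂μ := by
    have := sum_range_count_nth q (fun j k => ∫ x, f x * (f (T (T^[j] x)) *
        (f (S (S^[k] x)) - G (S (S^[k] x)))) ∂μ) (Nat.nth q N)
    rw [hN] at this
    rw [this]
    refine Finset.sum_congr rfl fun k _ => ?_
    rw [hcount, hq k]
    split_ifs <;> simp
  simp only [Function.comp_apply]
  rw [hnum, hden, ← add_div, ← Finset.sum_add_distrib]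
  congr 1
  refine Finset.sum_congr rfl fun j _ => ?_
  have hfm : ∀ n, Measurable fun y => f (T^[n] y) := fun n => hf.comp (hT.iterate n).measurable
  have hSm : ∀ n, Measurable (S^[n]) := fun n => (hS.iterate n).measurable
  simp only [← Function.iterate_succ_apply']
  have i1 : Integrable (fun y => f (T^[j + 1] y) * (f y * G y)) μ :=
    integrable_of_abs_le ((hfm _).mul (hf.mul hG)) 1 fun y =>
      abs_mul_le_one (hfa _) (abs_mul_le_one (hfa y) (hGa y))
  have i2 : Integrable (fun y => f y * (f (T^[j + 1] y) *
      (f (S^[Nat.nth q j + 1] y) - G (S^[Nat.nth q j + 1] y)))) μ :=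
    integrable_of_abs_le (hf.mul ((hfm _).mul
      ((hf.comp (hSm _)).sub (hG.comp (hSm _))))) 1 fun y =>
        abs_mul_le_one (hfa _) (abs_mul_le_one (hfa _) (hua _))
  refine (integral_add i1 i2).symm.trans (integral_congr_ae ?_)
  filter_upwards [ae_eq_comp_iterate hS hGS (Nat.nth q j + 1)] with y hy
  rw [Function.comp_apply] at hy
  rw [hy]; ring

end Triple

/-! ### Passage from the indicator sequence back to the random variables -/

theorem randomSeq_succ {Ω : Type*} (X : ℕ → Ω → ℝ) (ω : Ω)
    (hinf : (Set.ofPred fun k : ℕ => X (k + 1) ω = 1).Infinite) (j : ℕ) :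
    randomSeq X ω (j + 1) = Nat.nth (fun k : ℕ => X (k + 1) ω = 1) j + 1 := by
  set r : ℕ → Prop := fun k => 1 ≤ k ∧ X k ω = 1 with hr
  have hshift : (fun k => r (k + 1)) = fun k : ℕ => X (k + 1) ω = 1 := by
    funext k; simp [hr]
  have hrinf : (Set.ofPred r).Infinite := by
    refine Set.infinite_of_injective_forall_mem (f := fun j =>
      Nat.nth (fun k : ℕ => X (k + 1) ω = 1) j + 1)
      (fun i j h => Nat.nth_injective hinf (Nat.succ_injective h)) fun j => ?_
    exact ⟨Nat.le_add_left _ _, Nat.nth_mem_of_infinite hinf j⟩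
  -- `Nat.nth` takes the default value `0` when too few indices exist; infinitude rules this out.
  have hne : Nat.nth r j ≠ 0 := by
    have : 1 ≤ Nat.nth r j := (Nat.nth_mem_of_infinite hrinf j).1
    omega
  have := Nat.nth_add_one (p := r) (by simp [hr]) hne
  rw [hshift] at this
  rw [this]; rfl

theorem infinite_of_tendsto_sum {q : ℕ → Prop} [DecidablePred q] {s : ℕ → ℝ} {b : ℕ → ℕ}
    (hq : ∀ k, b k = if q k then 1 else 0) (hs0 : ∀ k, 0 < s k)
    (hp : Tendsto (fun m => (∑ k ∈ Finset.range m, (b k : ℝ)) / ∑ k ∈ Finset.range m, s k)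
      atTop (𝓝 1)) (hW : Tendsto (fun m => ∑ k ∈ Finset.range m, s k) atTop atTop) :
    (Set.ofPred q).Infinite := by
  have hB : Tendsto (fun m => ∑ k ∈ Finset.range m, (b k : ℝ)) atTop atTop := by
    refine (hp.pos_mul_atTop one_pos hW).congr' ?_
    filter_upwards [eventually_gt_atTop 0] with m hm
    exact div_mul_cancel₀ _ (sum_range_pos hs0 hm).ne'
  intro hfin
  obtain ⟨m, hm⟩ := (hB.eventually_gt_atTop (hfin.toFinset.card : ℝ)).exists
  refine absurd hm (not_lt.2 ?_)
  rw [← Nat.cast_sum, Finset.sum_congr rfl fun k _ => hq k, ← Finset.card_filter]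
  refine Nat.cast_le.2 (Finset.card_le_card fun k hk => ?_)
  simpa using (Finset.mem_filter.1 hk).2

theorem corollary1p2
    -- the selection probabilities are `σ_n = n ^ (-a)`
    (a : ℝ) (ha0 : 0 < a) (ha : a < 1 / 14)
    {Ω : Type*} [MeasurableSpace Ω] (P : Measure Ω) [IsProbabilityMeasure P]
    -- independent random variables `X_1, X_2, …` (the function `X 0` is not used)
    (X : ℕ → Ω → ℝ)
    (hmeas : ∀ n : ℕ, 1 ≤ n → Measurable (X n))
    (hindep : iIndepFun (fun n : ℕ => X (n + 1)) P)
    (hone : ∀ n : ℕ, 1 ≤ n → P {ω | X n ω = 1} = ENNReal.ofReal ((n : ℝ) ^ (-a)))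
    (hzero : ∀ n : ℕ, 1 ≤ n → P {ω | X n ω = 0} = ENNReal.ofReal (1 - (n : ℝ) ^ (-a))) :
    -- the set of `ω` of probability one does not depend on the system nor on the set `A`
    ∀ᵐ ω ∂P, ∀ (Y : Type*) [MeasurableSpace Y] (μ : Measure Y) [IsProbabilityMeasure μ]
      (T S : Y → Y), MeasurePreserving T μ μ → MeasurePreserving S μ μ → Function.Commute T S →
      ∀ A : Set Y, MeasurableSet A →
        ∃ L : ℝ,
          Tendsto (fun N : ℕ => (1 / (N : ℝ)) * ∑ n ∈ Finset.Icc 1 N,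
            μ.real (A ∩ T^[n] ⁻¹' A ∩ S^[randomSeq X ω n] ⁻¹' A)) atTop (𝓝 L) ∧
          μ.real A ^ 3 ≤ L := by
  classical
  set φ : ℝ → ℕ := fun x => if x = 1 then 1 else 0 with hφ
  have hφm : Measurable φ := Measurable.ite (measurableSet_singleton 1) measurable_const
    measurable_const
  -- The index is shifted by one: `b` starts at `0` and records `X 1, X 2, …`, matching `s k = (k +
  -- 1)^(-a)`.
  set b : ℕ → Ω → ℕ := fun k ω => φ (X (k + 1) ω) with hb
  have hbm : ∀ k, Measurable (b k) := fun k => hφm.comp (hmeas _ (Nat.le_add_left 1 k))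
  have hb1 : ∀ k ω, b k ω ≤ 1 := fun k ω => by simp only [hb, hφ]; split_ifs <;> simp
  have hind : iIndepFun b P := hindep.comp (fun _ => φ) fun _ => hφm
  have hs : ∀ k, ∫ ω, (b k ω : ℝ) ∂P = ((k : ℝ) + 1) ^ (-a) := fun k => by
    have hset : MeasurableSet {ω | X (k + 1) ω = 1} :=
      hmeas _ (Nat.le_add_left 1 k) (measurableSet_singleton 1)
    have e : ∀ ω, (b k ω : ℝ) = Set.indicator {ω | X (k + 1) ω = 1} 1 ω := fun ω => by
      simp only [hb, hφ, Set.indicator_apply, Set.mem_ofPred_eq, Pi.one_apply]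
      split_ifs <;> simp
    simp only [e]
    rw [integral_indicator_one hset, Measure.real, hone _ (Nat.le_add_left 1 k),
      ENNReal.toReal_ofReal (by positivity)]
    push_cast; rfl
  have hs0 : ∀ k : ℕ, 0 < ((k : ℝ) + 1) ^ (-a) := fun k => by positivity
  have hsa := rpow_neg_antitone ha0
  have hs1 := rpow_neg_le_one ha0
  have hst : Tendsto (fun k : ℕ => ((k : ℝ) + 1) ^ (-a)) atTop (𝓝 0) :=
    (tendsto_rpow_neg_atTop ha0).comp (tendsto_atTop_add_const_right _ 1 tendsto_natCast_atTop_atTop)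
  have hW : Tendsto (fun m : ℕ => ∑ k ∈ Finset.range m, ((k : ℝ) + 1) ^ (-a)) atTop atTop := by
    have h1 : Tendsto (fun m : ℕ => (m : ℝ) ^ (1 - a)) atTop atTop :=
      (tendsto_rpow_atTop (by linarith)).comp tendsto_natCast_atTop_atTop
    refine tendsto_atTop_mono' _ ?_ h1
    filter_upwards [eventually_gt_atTop 0] with m hm
    exact le_sum_rpow_neg ha0 hm
  filter_upwards [ae_hasSmallCorrelations ha0 ha hbm hb1 hind hs] with ω hω
  intro Y _ μ _ T S hT hS hTS A hA
  have hinf : (Set.ofPred fun k : ℕ => X (k + 1) ω = 1).Infinite :=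
    infinite_of_tendsto_sum (b := fun k => b k ω) (fun k => rfl) hs0
      (tendsto_partial_count_div hω (fun k => hb1 k ω) hsa hs0 hs1) hW
  set f : Y → ℝ := A.indicator 1 with hf
  have hfm : Measurable f := measurable_one.indicator hA
  obtain ⟨L, hL, hL3⟩ := exists_tendsto_triple_average (μ := μ) (f := f) hω
    (q := fun k : ℕ => X (k + 1) ω = 1) (fun k => rfl) hsa hs0 hs1 hst hW hinf hT hS hTS hfm
    (fun y => Set.indicator_nonneg (fun _ _ => zero_le_one) y)
    (fun y => Set.indicator_le_self' (fun _ _ => zero_le_one) y)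
  refine ⟨L, hL.congr fun N => ?_, ?_⟩
  · rw [one_div, div_eq_inv_mul, ← Finset.Ico_add_one_right_eq_Icc, Finset.sum_Ico_eq_sum_range]
    congr 1
    refine Finset.sum_congr (by rw [Nat.add_sub_cancel]) fun j _ => ?_
    rw [add_comm 1 j, randomSeq_succ X ω hinf, measureReal_inter_eq_integral hA
      ((hT.iterate _).measurable hA) ((hS.iterate _).measurable hA)]
    rfl
  · rwa [hf, integral_indicator_one hA] at hL3
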